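/- **Setting.** Let $\mathbb S^{d-1}$ be the unit sphere of $\mathbb R^d$, $B(q,r)=\{x\in\mathbb S^{d-1}:\langle q,x\rangle\ge r\}$, and for $0\le\beta<\alpha<1$ let $$\rho=\rho(\alpha,\beta)=\frac{(1-\alpha^2)(1-\beta^2)}{(1-\alpha\beta)^2}.$$ A dataset $S$ is a finite multiset of points of $\mathbb S^{d-1}$; $|S\cap B(q,r)|$ is counted with multiplicity. Two datasets are neighbouring if one arises from the other by adding one point. A randomized algorithm $M$ is $(\varepsilon,\delta)$-differentially private if $\Pr[M(S)\in Y]\le e^{\varepsilon}\Pr[M(S')\in Y]+\delta$ for all neighbouring $S,S'$ and all measurable $Y$. Let $A=\frac1\varepsilon\log\bigl(1+\frac{e^\varepsilon-1}{2\delta}\bigr)$, and let $\mathrm{TLap}(1,\varepsilon,\delta)$ be the probability distribution on $[-A,A]$ with density proportional to $e^{-\varepsilon|x|}$. **The DPTop-1 data structure.** CONSTRUCTION, for a public size parameter $n$, sets $$m=\Bigl\lceil n^{(1-\beta^2)/(1-\alpha\beta)^2}\Bigr\rceil,\qquad \eta=\alpha\sqrt{2\log m}-\sqrt{2(1-\alpha^2)\log\log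 m},$$ draws independent standard Gaussian vectors $a_1,\dots,a_m\in\mathbb R^d$, and lets $T[i]$ be the number of points $x\in S$ with $i=\arg\max_{j\in[m]}\langle a_j,x\rangle$ (the first such index in case of ties). It then adds an independent $\mathrm{TLap}(1,\varepsilon,\delta)$ variable to each $T[i]$, replaces every resulting $T[i]\le A$ by $0$, and returns $\mathcal D=(T,(a_i)_i,m,\eta)$. QUERY$(q)$ returns $\widetilde{\mathrm{ans}}=\sum_{i:\langle a_i,q\rangle\ge\eta}T[i]$. **Theorem.** 1. *Privacy.* For all $d,n$, all $0\le\beta<\alpha<1$, $\varepsilon>0$ and $\delta\in(0,\frac12)$, CONSTRUCTION with size parameter $n$ is $(\varepsilon,\delta)$-differentially private. 2. *Accuracy.* Let $0\le\beta_n<\alpha_n<1$ be sequences (for example constant ones) such that, as $n\to\infty$, $$\alpha_n-\beta_n=\omega\Bigl((1-\alpha_n^2)\sqrt{\tfrac{\log\log n}{\log n}}\Bigr)\quad\text{and}\quad 1-\alpha_n^2=\omega\Bigl(\tfrac{\log\log m_n}{\log m_n}\Bigr),$$ where $m_n$ is the number $m$ for $n,\alpha_n,\beta_n$; put $\rho_n=\rho(\alpha_n,\beta_n)$.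 Then there are sequences $e_1(n),e_2(n)\to0$ such that for every $\varepsilon_0>0$ there is a constant $C>0$ with the following property for all sufficiently large $n$: for all $d$, $\varepsilon\in(0,\varepsilon_0]$, $\delta\in(0,\frac12)$, all $S$ with $|S|=n$ and all $q\in\mathbb S^{d-1}$, with probability at least $2/3$, $$(1-e_1(n))\,|S\cap B(q,\alpha_n)|-C\,\frac{\log(1/\delta)}{\varepsilon}\,n^{\rho_n+e_2(n)}\le\widetilde{\mathrm{ans}}\le|S\cap B(q,\beta_n)|+C\,\frac{\log(1/\delta)}{\varepsilon}\,n^{\rho_n+e_2(n)}.$$ 3. *Complexity.* On a real RAM with unit-cost instructions (real arithmetic, $\exp$, $\log$, square root, ceiling, integer arithmetic, comparisons, memory access, and drawing one $N(0,1)$ or one $\mathrm{TLap}(1,\varepsilon,\delta)$ variable), there are fixed programs for CONSTRUCTION and QUERY and an absolute constant $C$ such that for all $d,n\ge1$, $0\le\beta<\alpha<1$, $\varepsilon>0$, $\delta\in(0,\frac12)$, every dataset of $n$ points and every outcome of the draws, CONSTRUCTION takes at most $C\,d\,n^{1+\rho/(1-\alpha^2)}$ steps, every query takes at most $C\,d\,n^{\rho/(1-\alpha^2)}$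 steps, and both run in $C\,d\,n^{\rho/(1-\alpha^2)}$ words of memory, in which the data structure is stored. -/

import Mathlib

open Filter Topology MeasureTheory ProbabilityTheory Asymptotics
open scoped ENNReal NNReal RealInnerProductSpace

noncomputable section

namespace DPTopOne

/-! ### The unit sphere, datasets and balls -/

/-- Euclidean space of dimension `d`. -/
abbrev Vec (d : ℕ) : Type := EuclideanSpace ℝ (Fin d)

/-- The unit sphere of `d`-dimensional Euclidean space. -/
abbrev Sph (d : ℕ) : Type := Metric.sphere (0 : Vec d) 1

open Classical in
/-- `|S ∩ B(q, r)|` where `B(q, r) = {x | ⟪q, x⟫ ≥ r}`: the number of points of the dataset `S`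
(counted with multiplicity) whose inner product with `q` is at least `r`. -/
def ballCount {d : ℕ} (S : Multiset (Sph d)) (q : Sph d) (r : ℝ) : ℕ :=
  (S.filter fun x => r ≤ ⟪(q : Vec d), (x : Vec d)⟫).card

/-! ### Differential privacy -/

/-- Two datasets are neighbouring (addition/removal) if one of them is obtained from the other by
adding one point. -/
def Neighbouring {X : Type*} (S S' : Multiset X) : Prop :=
  ∃ x, S' = x ::ₘ S ∨ S = x ::ₘ S'

/-- `(ε, δ)`-differential privacy of a randomized algorithm, given by its output law `M S` on every
dataset `S`. -/
def IsDP {X O : Type*} [MeasurableSpace O] (ε δ : ℝ) (M : Multiset X → Measure O) : Prop :=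
  ∀ S S' : Multiset X, Neighbouring S S' → ∀ Y : Set O, MeasurableSet Y →
    M S Y ≤ ENNReal.ofReal (Real.exp ε) * M S' Y + ENNReal.ofReal δ

/-- The truncation radius of the truncated Laplace distribution with sensitivity `Δ`. -/
def tlapRadius (Δ ε δ : ℝ) : ℝ := Δ / ε * Real.log (1 + (Real.exp ε - 1) / (2 * δ))

/-- The unnormalized truncated Laplace distribution: density `exp (-|x| ε / Δ)` on `[-A, A]`, where
`A` is the truncation radius, and `0` elsewhere. -/
def tlapWeight (Δ ε δ : ℝ) : Measure ℝ :=
  (volume.restrict (Set.Icc (-tlapRadius Δ ε δ) (tlapRadius Δ ε δ))).withDensity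
    fun x => ENNReal.ofReal (Real.exp (-(|x| * ε / Δ)))

/-- The truncated Laplace distribution `TLap(Δ, ε, δ)`. -/
def tlap (Δ ε δ : ℝ) : Measure ℝ := (tlapWeight Δ ε δ Set.univ)⁻¹ • tlapWeight Δ ε δ

/-! ### The data structure -/

/-- The exponent `ρ`. -/
def rho (α β : ℝ) : ℝ := (1 - α ^ 2) * (1 - β ^ 2) / (1 - α * β) ^ 2

/-- The number `m` of Gaussian filters for dataset size `n`. -/
def numFilters (n : ℕ) (α β : ℝ) : ℕ := ⌈(n : ℝ) ^ ((1 - β ^ 2) / (1 - α * β) ^ 2)⌉₊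

/-- The query threshold `η`. -/
def threshold (m : ℕ) (α : ℝ) : ℝ :=
  α * √(2 * Real.log m) - √(2 * (1 - α ^ 2) * Real.log (Real.log m))

/-- The released data structure with `m` filters in dimension `d`: the table of counters, the
filters, the query threshold. -/
structure Data (d m : ℕ) where
  table : Fin m → ℝ
  filters : Fin m → Vec d
  eta : ℝ

/-- A data structure as a tuple of its components. -/
def Data.toTuple {d m : ℕ} (D : Data d m) : (Fin m → ℝ) × (Fin m → Vec d) × ℝ :=
  (D.table, D.filters, D.eta)

/-- The sigma-algebra on data structures is the product one. -/
instance (d m : ℕ) : MeasurableSpace (Data d m) := MeasurableSpace.comap Data.toTuple inferInstance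

/-- `i` is the index (the first one, in case of ties) of the filter with the largest inner product
with `x`. -/
def IsArgmax {d m : ℕ} (a : Fin m → Vec d) (x : Vec d) (i : Fin m) : Prop :=
  (∀ j, ⟪a j, x⟫ ≤ ⟪a i, x⟫) ∧ ∀ j < i, ⟪a j, x⟫ < ⟪a i, x⟫

open Classical in
/-- The number of points of the dataset that are assigned to filter `i`. -/
def bucketCount {d m : ℕ} (a : Fin m → Vec d) (S : Multiset (Sph d)) (i : Fin m) : ℕ :=
  (S.filter fun x => IsArgmax a (x : Vec d) i).card

/-- CONSTRUCTION for given values of the random draws: `g i j` is the `j`-th coordinate of the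
`i`-th filter and `z i` is the noise added to the `i`-th counter. The size `n` that determines the
number of filters is a parameter of its own (a public quantity). -/
def build {d : ℕ} (n : ℕ) (α β ε δ : ℝ) (S : Multiset (Sph d))
    (g : Fin (numFilters n α β) → Fin d → ℝ) (z : Fin (numFilters n α β) → ℝ) :
    Data d (numFilters n α β) where
  table i :=
    if (bucketCount (fun k => WithLp.toLp 2 (g k)) S i : ℝ) + z i ≤ tlapRadius 1 ε δ then 0
    else (bucketCount (fun k => WithLp.toLp 2 (g k)) S i : ℝ) + z i
  filters k := WithLp.toLp 2 (g k)
  eta := threshold (numFilters n α β) α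

/-- The law of the random draws: all independent, standard Gaussian coordinates and truncated
Laplace noise. -/
def drawLaw (d m : ℕ) (ε δ : ℝ) : Measure ((Fin m → Fin d → ℝ) × (Fin m → ℝ)) :=
  (Measure.pi fun _ => Measure.pi fun _ => gaussianReal 0 1).prod (Measure.pi fun _ => tlap 1 ε δ)

/-- The output law of CONSTRUCTION on the dataset `S`. -/
def construction {d : ℕ} (n : ℕ) (α β ε δ : ℝ) (S : Multiset (Sph d)) :
    Measure (Data d (numFilters n α β)) :=
  (drawLaw d (numFilters n α β) ε δ).map fun ω => build n α β ε δ S ω.1 ω.2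

open Classical in
/-- QUERY: the sum of the counters of the filters whose inner product with `q` reaches the
threshold. -/
def Data.query {d m : ℕ} (D : Data d m) (q : Sph d) : ℝ :=
  ∑ i with D.eta ≤ ⟪D.filters i, (q : Vec d)⟫, D.table i

/-- The number of memory words of the data structure (filters, counters, threshold). -/
def Data.words {d m : ℕ} (_ : Data d m) : ℕ := 1 + m + m * d

/-! ### A randomized real RAM with unit-cost instructions

Finitely many integer and real registers are used by each program; the memory consists of real
words addressed by integer registers. -/

namespace RAM

/-- What a computation can only read: the input array, and two sources of random draws, each read
sequentially. -/
structure Env where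
  input : ℕ → ℝ
  gauss : ℕ → ℝ
  noise : ℕ → ℝ

/-- Machine states: integer registers, real registers, memory, and the number of draws already taken
from each source. -/
structure State where
  int : ℕ → ℕ
  real : ℕ → ℝ
  mem : ℕ → ℝ
  gaussPos : ℕ
  noisePos : ℕ

/-- Instructions; the first argument names the target register. -/
inductive Instr
  | intConst (i k : ℕ)
  | intAdd (i j k : ℕ)
  | intSub (i j k : ℕ)
  | intMul (i j k : ℕ)
  | ofInt (i j : ℕ)
  | add (i j k : ℕ)
  | sub (i j k : ℕ)
  | mul (i j k : ℕ)
  | div (i j k : ℕ)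
  | exp (i j : ℕ)
  | log (i j : ℕ)
  | sqrt (i j : ℕ)
  | ceil (i j : ℕ)
  | input (i j : ℕ)
  | load (i j : ℕ)
  | store (i j : ℕ)
  | gauss (i : ℕ)
  | noise (i : ℕ)

/-- Write an integer register. -/
def State.setInt (s : State) (i v : ℕ) : State := { s with int := Function.update s.int i v }

/-- Write a real register. -/
def State.setReal (s : State) (i : ℕ) (v : ℝ) : State :=
  { s with real := Function.update s.real i v }

/-- The effect of an instruction. -/
def Instr.exec (E : Env) (s : State) : Instr → State
  | intConst i k => s.setInt i k
  | intAdd i j k => s.setInt i (s.int j + s.int k)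
  | intSub i j k => s.setInt i (s.int j - s.int k)
  | intMul i j k => s.setInt i (s.int j * s.int k)
  | ofInt i j => s.setReal i (s.int j : ℝ)
  | add i j k => s.setReal i (s.real j + s.real k)
  | sub i j k => s.setReal i (s.real j - s.real k)
  | mul i j k => s.setReal i (s.real j * s.real k)
  | div i j k => s.setReal i (s.real j / s.real k)
  | exp i j => s.setReal i (Real.exp (s.real j))
  | log i j => s.setReal i (Real.log (s.real j))
  | sqrt i j => s.setReal i (√(s.real j))
  | ceil i j => s.setInt i ⌈s.real j⌉₊
  | input i j => s.setReal i (E.input (s.int j))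
  | load i j => s.setReal i (s.mem (s.int j))
  | store i j => { s with mem := Function.update s.mem (s.int i) (s.real j) }
  | gauss i => { s.setReal i (E.gauss s.gaussPos) with gaussPos := s.gaussPos + 1 }
  | noise i => { s.setReal i (E.noise s.noisePos) with noisePos := s.noisePos + 1 }

/-- An instruction can be executed on a machine with `K` words of memory if it accesses only
addresses below `K`. -/
def Instr.Allowed (K : ℕ) (s : State) : Instr → Prop
  | load _ j => s.int j < K
  | store i _ => s.int i < K
  | _ => True

/-- Tests. -/
inductive Test
  | intLt (i j : ℕ)
  | realLe (i j : ℕ)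

/-- The meaning of a test. -/
def Test.Holds (s : State) : Test → Prop
  | intLt i j => s.int i < s.int j
  | realLe i j => s.real i ≤ s.real j

/-- Programs. -/
inductive Prog
  | skip
  | instr (c : Instr)
  | seq (p q : Prog)
  | ite (b : Test) (p q : Prog)
  | loop (b : Test) (p : Prog)

/-- `Run E K p s t s'`: on a machine with `K` words of memory and read-only data `E`, the program
`p` started in state `s` halts in state `s'` after `t` steps. Every executed instruction and every
evaluated test is one step. -/
inductive Run (E : Env) (K : ℕ) : Prog → State → ℕ → State → Prop
  | skip (s : State) : Run E K .skip s 0 s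
  | instr (c : Instr) (s : State) (h : c.Allowed K s) : Run E K (.instr c) s 1 (c.exec E s)
  | seq {p q : Prog} {s s' s'' : State} {t t' : ℕ} (h : Run E K p s t s')
      (h' : Run E K q s' t' s'') : Run E K (.seq p q) s (t + t') s''
  | iteTrue {b : Test} {p q : Prog} {s s' : State} {t : ℕ} (hb : b.Holds s)
      (h : Run E K p s t s') : Run E K (.ite b p q) s (t + 1) s'
  | iteFalse {b : Test} {p q : Prog} {s s' : State} {t : ℕ} (hb : ¬ b.Holds s)
      (h : Run E K q s t s') : Run E K (.ite b p q) s (t + 1) s'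
  | loopTrue {b : Test} {p : Prog} {s s' s'' : State} {t t' : ℕ} (hb : b.Holds s)
      (h : Run E K p s t s') (h' : Run E K (.loop b p) s' t' s'') :
      Run E K (.loop b p) s (t + t' + 1) s''
  | loopFalse {b : Test} {p : Prog} {s : State} (hb : ¬ b.Holds s) : Run E K (.loop b p) s 1 s

/-- The data structure `D` is stored in state `s`: the integer registers `0` and `1` hold `m` and
`d`, and the memory holds the threshold, then the counters, then the filters row by row. -/
def Stores {d m : ℕ} (s : State) (D : Data d m) : Prop :=
  s.int 0 = m ∧ s.int 1 = d ∧ s.mem 0 = D.eta ∧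
    (∀ i : Fin m, s.mem (1 + i) = D.table i) ∧
    ∀ (i : Fin m) (j : Fin d), s.mem (1 + m + (i * d + j)) = D.filters i j

/-- Initial configurations of CONSTRUCTION: integer registers `0` and `1` hold `n` and `d`, real
registers `0` to `3` hold `α, β, ε, δ`, the input array holds the dataset row by row, and the random
sources, not yet used, start with the draws `g` (row by row) and `z`. -/
def Init {n d m : ℕ} (α β ε δ : ℝ) (x : Fin n → Sph d) (g : Fin m → Fin d → ℝ) (z : Fin m → ℝ)
    (E : Env) (s : State) : Prop :=
  s.int 0 = n ∧ s.int 1 = d ∧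
    s.real 0 = α ∧ s.real 1 = β ∧ s.real 2 = ε ∧ s.real 3 = δ ∧
    s.gaussPos = 0 ∧ s.noisePos = 0 ∧
    (∀ (i : Fin n) (j : Fin d), E.input (i * d + j) = (x i : Vec d) j) ∧
    (∀ (i : Fin m) (j : Fin d), E.gauss (i * d + j) = g i j) ∧
    ∀ i : Fin m, E.noise i = z i

end RAM

end DPTopOne

end

open DPTopOne

noncomputable section

namespace DPTopOne

/-! ### The truncated Laplace distribution -/

/-! Privacy. Fix the filters. Every point lies in exactly one bucket, so the counts of neighbouring
datasets differ by 1 in a single coordinate, and the two outputs differ by a shift of one noise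
variable by ±1 (`exists_build_shift`). Truncated Laplace noise tolerates this shift
(`tlap_shift_le`): the density changes by a factor of at most e^ε, except on the last unit interval
of the support, and the radius A is such that this interval has mass at most δ. The law of the
filters does not depend on the data, so the inequality survives integration over them.

Accuracy. Let l = log m and σ = (1-β²)/(1-αβ)², so l ≈ σ log n. The largest inner product of x with
the m filters is close to √(2l), and the inner product of the winning filter with q is then about
⟪x,q⟫√(2l), with variance 1-⟪x,q⟫². Hence: - the threshold lies √(2(1-α²) log l) below α√(2l), so a
near point is missed with probability o(1) (`near_exponent_le`); - a far point is found with
probability about exp(-(α-β)² l/(1-β²)), and n times this is about n^ρ because 1-ρ = σ(α-β)²/(1-β²)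
(`far_exponent_le`, `one_sub_rho`); - about m^(1-α²) filters are queried, which is again about n^ρ
because ρ = σ(1-α²), and each adds an error of at most 2A (`query_exponent_le`, `rho_eq`). So m
balances the last two errors. No conditioning is used: `gaussFilters_argmax_le` splits according to
whether some filter reaches a level M slightly below √(2l), and applies a union bound with a
two-dimensional Chernoff bound. Markov's inequality for the three counts gives probability 2/3
(`construction_accuracy`). Lower-order terms are multiples of `slack`, which tends to 0 by the
assumption on 1-α².

Complexity. Explicit programs are verified by loop invariants in a Hoare logic that counts steps
(`Ends`). The cost is dominated by the n·m inner products of length d, and m ≤ 2n^σ with σ =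
ρ/(1-α²). -/

lemma exp_mul_tlapRadius {ε δ : ℝ} (hε : 0 < ε) (hδ : 0 < δ) :
    Real.exp (ε * tlapRadius 1 ε δ) = 1 + (Real.exp ε - 1) / (2 * δ) := by
  have h1 : 0 ≤ (Real.exp ε - 1) / (2 * δ) :=
    div_nonneg (by linarith [Real.add_one_le_exp ε]) (by positivity)
  rw [tlapRadius, ← mul_assoc, mul_one_div_cancel hε.ne', one_mul, Real.exp_log (by linarith)]

lemma one_le_tlapRadius {ε δ : ℝ} (hε : 0 < ε) (hδ : 0 < δ) (hδ' : δ < 1 / 2) :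
    1 ≤ tlapRadius 1 ε δ := by
  have h1 : 0 < Real.exp ε - 1 := by linarith [Real.add_one_lt_exp hε.ne']
  have h2 : Real.exp (ε * 1) ≤ Real.exp (ε * tlapRadius 1 ε δ) := by
    rw [exp_mul_tlapRadius hε hδ, mul_one]
    have : Real.exp ε - 1 ≤ (Real.exp ε - 1) / (2 * δ) := by
      rw [le_div_iff₀ (by positivity)]; nlinarith
    linarith
  exact le_of_mul_le_mul_left (Real.exp_le_exp.1 h2) hε

lemma measurable_tlapDensity (ε : ℝ) :
    Measurable fun x : ℝ => ENNReal.ofReal (Real.exp (-(|x| * ε / 1))) := by fun_prop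

lemma tlapWeight_apply {ε δ : ℝ} {Y : Set ℝ} (hY : MeasurableSet Y) :
    tlapWeight 1 ε δ Y = ∫⁻ x, (Set.Icc (-tlapRadius 1 ε δ) (tlapRadius 1 ε δ) ∩ Y).indicator
      (fun x => ENNReal.ofReal (Real.exp (-(|x| * ε / 1)))) x := by
  rw [tlapWeight, withDensity_apply _ hY, Measure.restrict_restrict hY,
    ← lintegral_indicator (hY.inter measurableSet_Icc), Set.inter_comm]

lemma tlapWeight_neg {ε δ : ℝ} {Y : Set ℝ} (hY : MeasurableSet Y) :
    tlapWeight 1 ε δ {x | -x ∈ Y} = tlapWeight 1 ε δ Y := by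
  have hY' : MeasurableSet {x : ℝ | -x ∈ Y} := measurable_neg hY
  rw [tlapWeight_apply hY, tlapWeight_apply hY', ← lintegral_neg_eq_self]
  refine lintegral_congr fun x => ?_
  by_cases h : x ∈ Set.Icc (-tlapRadius 1 ε δ) (tlapRadius 1 ε δ) ∩ Y
  · rw [Set.indicator_of_mem h, Set.indicator_of_mem, abs_neg]
    exact ⟨⟨neg_le_neg h.1.2, by linarith [h.1.1]⟩, by simpa using h.2⟩
  · rw [Set.indicator_of_notMem h, Set.indicator_of_notMem]
    rintro ⟨h1, h2⟩
    exact h ⟨⟨by linarith [h1.2], by linarith [h1.1]⟩, by simpa using h2⟩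

lemma tlapWeight_Ioc {ε δ a b : ℝ} (hε : 0 < ε) (ha : 0 ≤ a) (hab : a ≤ b)
    (hb : b ≤ tlapRadius 1 ε δ) :
    tlapWeight 1 ε δ (Set.Ioc a b) =
      ENNReal.ofReal ((Real.exp (-(a * ε)) - Real.exp (-(b * ε))) / ε) := by
  have hsub : Set.Ioc a b ⊆ Set.Icc (-tlapRadius 1 ε δ) (tlapRadius 1 ε δ) := fun x hx =>
    ⟨by linarith [hx.1], hx.2.trans hb⟩
  have hI : ∫ x in a..b, Real.exp (-(x * ε)) =
      (Real.exp (-(a * ε)) - Real.exp (-(b * ε))) / ε := by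
    have hd : ∀ x ∈ Set.uIcc a b,
        HasDerivAt (fun x => -Real.exp (-(x * ε)) / ε) (Real.exp (-(x * ε))) x := by
      intro x _
      have h := (((hasDerivAt_id x).mul_const ε).neg.exp).neg.div_const ε
      refine h.congr_deriv ?_
      simp only [id, Pi.neg_apply]
      field_simp
    rw [intervalIntegral.integral_eq_sub_of_hasDerivAt hd
      (Continuous.intervalIntegrable (by fun_prop) _ _)]
    ring
  rw [tlapWeight, withDensity_apply _ measurableSet_Ioc,
    Measure.restrict_restrict measurableSet_Ioc, Set.inter_eq_left.2 hsub, ← hI,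
    intervalIntegral.integral_of_le hab, ofReal_integral_eq_lintegral_ofReal]
  · refine setLIntegral_congr_fun measurableSet_Ioc fun x hx => ?_
    rw [abs_of_pos (ha.trans_lt hx.1), div_one]
  · exact ((Continuous.intervalIntegrable (by fun_prop) a b).1)
  · exact Eventually.of_forall fun x => (Real.exp_pos _).le

/-- The interval (0, A] and its mirror image exhaust the support up to the origin. A lower bound on
the normalizing constant is all that the tail estimate needs. -/
lemma tlapWeight_univ_ge {ε δ : ℝ} (hε : 0 < ε) (hδ : 0 < δ) (hδ' : δ < 1 / 2) :
    ENNReal.ofReal (2 * (1 - Real.exp (-(tlapRadius 1 ε δ * ε))) / ε) ≤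
      tlapWeight 1 ε δ Set.univ := by
  have hA := one_le_tlapRadius hε hδ hδ'
  have h1 := tlapWeight_Ioc (δ := δ) hε le_rfl (zero_le_one.trans hA) le_rfl
  have hm : MeasurableSet {x : ℝ | -x ∈ Set.Ioc 0 (tlapRadius 1 ε δ)} :=
    measurable_neg measurableSet_Ioc
  have h2 := tlapWeight_neg (ε := ε) (δ := δ)
    (measurableSet_Ioc (a := (0 : ℝ)) (b := tlapRadius 1 ε δ))
  have hd : Disjoint (Set.Ioc 0 (tlapRadius 1 ε δ)) {x : ℝ | -x ∈ Set.Ioc 0 (tlapRadius 1 ε δ)} := by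
    rw [Set.disjoint_left]
    intro x hx hx'
    have := hx.1
    have := hx'.1
    linarith
  have h3 := measure_union hd hm (μ := tlapWeight 1 ε δ)
  rw [h2, h1] at h3
  have hnn : 0 ≤ (Real.exp (-(0 * ε)) - Real.exp (-(tlapRadius 1 ε δ * ε))) / ε :=
    div_nonneg (sub_nonneg.2 (Real.exp_le_exp.2 (by nlinarith))) hε.le
  rw [← ENNReal.ofReal_add hnn hnn] at h3
  calc _ = _ := by congr 1; rw [zero_mul, neg_zero, Real.exp_zero]; ring
    _ ≤ _ := h3 ▸ measure_mono (Set.subset_univ _)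

lemma tlapWeight_univ_ne_zero {ε δ : ℝ} (hε : 0 < ε) (hδ : 0 < δ) (hδ' : δ < 1 / 2) :
    tlapWeight 1 ε δ Set.univ ≠ 0 := by
  have hA := one_le_tlapRadius hε hδ hδ'
  refine ((ENNReal.ofReal_pos.2 ?_).trans_le (tlapWeight_univ_ge hε hδ hδ')).ne'
  have : Real.exp (-(tlapRadius 1 ε δ * ε)) < 1 := Real.exp_lt_one_iff.2 (by nlinarith)
  exact div_pos (by linarith) hε

lemma tlapWeight_univ_ne_top {ε δ : ℝ} (hε : 0 < ε) : tlapWeight 1 ε δ Set.univ ≠ ⊤ := by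
  rw [tlapWeight, withDensity_apply _ MeasurableSet.univ, Measure.restrict_univ]
  refine ne_of_lt (lt_of_le_of_lt (lintegral_mono (g := fun _ => 1) fun x => ?_) ?_)
  · rw [← ENNReal.ofReal_one]
    refine ENNReal.ofReal_le_ofReal (Real.exp_le_one_iff.2 ?_)
    have := abs_nonneg x
    rw [div_one, neg_nonpos]; positivity
  · simp

lemma isProbabilityMeasure_tlap {ε δ : ℝ} (hε : 0 < ε) (hδ : 0 < δ) (hδ' : δ < 1 / 2) :
    IsProbabilityMeasure (tlap 1 ε δ) :=
  ⟨by rw [tlap, Measure.smul_apply, smul_eq_mul,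
    ENNReal.inv_mul_cancel (tlapWeight_univ_ne_zero hε hδ hδ') (tlapWeight_univ_ne_top hε)]⟩

lemma ae_tlap_abs_le {ε δ : ℝ} : ∀ᵐ x ∂tlap 1 ε δ, |x| ≤ tlapRadius 1 ε δ := by
  have h : ∀ᵐ x ∂tlapWeight 1 ε δ, |x| ≤ tlapRadius 1 ε δ := by
    refine (withDensity_absolutelyContinuous _ _).ae_le ?_
    filter_upwards [ae_restrict_mem measurableSet_Icc] with x hx using abs_le.2 hx
  exact Measure.ae_smul_measure h _

lemma tlapWeight_shift_le {ε δ : ℝ} (hε : 0 < ε) (hδ : 0 < δ) (hδ' : δ < 1 / 2) {Y : Set ℝ}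
    (hY : MeasurableSet Y) :
    tlapWeight 1 ε δ {x | x + 1 ∈ Y} ≤ ENNReal.ofReal (Real.exp ε) * tlapWeight 1 ε δ Y +
      ENNReal.ofReal δ * tlapWeight 1 ε δ Set.univ := by
  set A := tlapRadius 1 ε δ with hAdef
  have hA := one_le_tlapRadius hε hδ hδ'
  have hY' : MeasurableSet {x : ℝ | x + 1 ∈ Y} := (measurable_id.add_const (1 : ℝ)) hY
  -- This mass is exactly δ times the lower bound of `tlapWeight_univ_ge`; the equality is the
  -- equation e^(εA) = 1 + (e^ε - 1)/(2δ) that determines A.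
  have htail : tlapWeight 1 ε δ (Set.Ioc (A - 1) A) ≤
      ENNReal.ofReal δ * tlapWeight 1 ε δ Set.univ := by
    refine le_trans (le_of_eq ?_) (mul_le_mul_right (tlapWeight_univ_ge hε hδ hδ') _)
    rw [tlapWeight_Ioc hε (by linarith) (by linarith) le_rfl, ← ENNReal.ofReal_mul hδ.le]
    congr 1
    have h1 : Real.exp (-((A - 1) * ε)) = Real.exp ε * Real.exp (-(A * ε)) := by
      rw [← Real.exp_add]; ring_nf
    have h2 : Real.exp (-(A * ε)) * Real.exp (ε * A) = 1 := by
      rw [← Real.exp_add]; simp [mul_comm]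
    rw [hAdef, exp_mul_tlapRadius hε hδ, ← hAdef] at h2
    rw [h1, ← hAdef]
    field_simp at h2 ⊢
    linear_combination h2
  refine le_trans ?_ (add_le_add_right htail _)
  -- All masses become integrals over the line, the one of Y translated by 1, so that a pointwise
  -- comparison suffices. If x + 1 ≤ A, then |x + 1| ≤ |x| + 1 bounds the density ratio by e^ε;
  -- otherwise x lies in the tail (A - 1, A].
  rw [tlapWeight_apply hY', tlapWeight_apply hY, tlapWeight_apply measurableSet_Ioc,
    ← lintegral_const_mul _ ((measurable_tlapDensity ε).indicator (measurableSet_Icc.inter hY)),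
    ← lintegral_add_right_eq_self
      (fun x => ENNReal.ofReal (Real.exp ε) * (Set.Icc (-A) A ∩ Y).indicator
        (fun x => ENNReal.ofReal (Real.exp (-(|x| * ε / 1)))) x) 1,
    ← lintegral_add_right _
      ((measurable_tlapDensity ε).indicator (measurableSet_Icc.inter measurableSet_Ioc))]
  refine lintegral_mono fun x => ?_
  by_cases hx : x ∈ Set.Icc (-A) A ∩ {x | x + 1 ∈ Y}
  swap
  · simp only
    rw [Set.indicator_of_notMem hx]; exact zero_le
  simp only
  rw [Set.indicator_of_mem hx]
  by_cases hxA : x + 1 ≤ A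
  · refine le_add_right ?_
    have hx1 : x + 1 ∈ Set.Icc (-A) A ∩ Y := ⟨⟨by linarith [hx.1.1], hxA⟩, hx.2⟩
    rw [Set.indicator_of_mem hx1, ← ENNReal.ofReal_mul (Real.exp_pos _).le, ← Real.exp_add]
    refine ENNReal.ofReal_le_ofReal (Real.exp_le_exp.2 ?_)
    have := abs_add_le x 1
    rw [abs_one] at this
    nlinarith
  · refine le_add_left (le_of_eq ?_)
    have hx1 : x ∈ Set.Icc (-A) A ∩ Set.Ioc (A - 1) A := ⟨hx.1, ⟨by linarith, hx.1.2⟩⟩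
    rw [Set.indicator_of_mem hx1]

lemma tlap_shift_le {ε δ : ℝ} (hε : 0 < ε) (hδ : 0 < δ) (hδ' : δ < 1 / 2) {Y : Set ℝ}
    (hY : MeasurableSet Y) :
    tlap 1 ε δ {x | x + 1 ∈ Y} ≤ ENNReal.ofReal (Real.exp ε) * tlap 1 ε δ Y +
      ENNReal.ofReal δ := by
  have h := mul_le_mul_right (tlapWeight_shift_le hε hδ hδ' hY) (tlapWeight 1 ε δ Set.univ)⁻¹
  rw [mul_add, mul_left_comm, mul_left_comm _ (ENNReal.ofReal δ),
    ENNReal.inv_mul_cancel (tlapWeight_univ_ne_zero hε hδ hδ') (tlapWeight_univ_ne_top hε),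
    mul_one] at h
  simpa only [tlap, Measure.smul_apply, smul_eq_mul] using h

lemma tlap_neg {ε δ : ℝ} {Y : Set ℝ} (hY : MeasurableSet Y) :
    tlap 1 ε δ {x | -x ∈ Y} = tlap 1 ε δ Y := by
  simp only [tlap, Measure.smul_apply, tlapWeight_neg hY]

lemma tlap_shift_neg_le {ε δ : ℝ} (hε : 0 < ε) (hδ : 0 < δ) (hδ' : δ < 1 / 2) {Y : Set ℝ}
    (hY : MeasurableSet Y) :
    tlap 1 ε δ {x | x + -1 ∈ Y} ≤ ENNReal.ofReal (Real.exp ε) * tlap 1 ε δ Y +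
      ENNReal.ofReal δ := by
  have hY' : MeasurableSet {x : ℝ | -x ∈ Y} := measurable_neg hY
  have hm : MeasurableSet {x : ℝ | x + -1 ∈ Y} := (measurable_id.add_const (-1 : ℝ)) hY
  have h := tlap_shift_le hε hδ hδ' hY'
  rw [tlap_neg hY] at h
  rw [← tlap_neg hm]
  convert h using 3
  ext x
  simp only [Set.mem_ofPred_eq, neg_add]

/-- Moving one coordinate of independent truncated Laplace noise by `±1`. -/
lemma pi_tlap_shift_le {ε δ : ℝ} (hε : 0 < ε) (hδ : 0 < δ) (hδ' : δ < 1 / 2) {m : ℕ} (i : Fin m)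
    {c : ℝ} (hc : c = 1 ∨ c = -1) {B : Set (Fin m → ℝ)} (hB : MeasurableSet B) :
    (Measure.pi fun _ : Fin m => tlap 1 ε δ) {z | z + Pi.single i c ∈ B} ≤
      ENNReal.ofReal (Real.exp ε) * (Measure.pi fun _ : Fin m => tlap 1 ε δ) B +
        ENNReal.ofReal δ := by
  have := isProbabilityMeasure_tlap hε hδ hδ'
  obtain _ | k := m
  · exact i.elim0
  have hmp := (measurePreserving_piFinSuccAbove (fun _ : Fin (k + 1) => tlap 1 ε δ) i).symm
  set e := MeasurableEquiv.piFinSuccAbove (fun _ : Fin (k + 1) => ℝ) i with he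
  have hsymm : ∀ p : ℝ × (Fin k → ℝ), e.symm p = i.insertNth p.1 p.2 := fun _ => rfl
  have hB' : MeasurableSet {z : Fin (k + 1) → ℝ | z + Pi.single i c ∈ B} :=
    (measurable_id.add_const _) hB
  -- Fubini: with the other coordinates fixed, the shift acts on the one-dimensional sections in
  -- coordinate i.
  rw [← hmp.measure_preimage hB.nullMeasurableSet, ← hmp.measure_preimage hB'.nullMeasurableSet,
    Measure.prod_apply_symm (e.symm.measurable hB), Measure.prod_apply_symm (e.symm.measurable hB')]
  have h1 : ∀ y : Fin k → ℝ, tlap 1 ε δ ((fun x => (x, y)) ⁻¹'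
      (e.symm ⁻¹' {z | z + Pi.single i c ∈ B})) ≤ ENNReal.ofReal (Real.exp ε) *
        tlap 1 ε δ ((fun x => (x, y)) ⁻¹' (e.symm ⁻¹' B)) + ENNReal.ofReal δ := by
    intro y
    have hm : MeasurableSet ((fun x : ℝ => (x, y)) ⁻¹' (e.symm ⁻¹' B)) :=
      measurable_prodMk_right (e.symm.measurable hB)
    have hs : (fun x : ℝ => (x, y)) ⁻¹' (e.symm ⁻¹' {z | z + Pi.single i c ∈ B}) =
        {x | x + c ∈ (fun x : ℝ => (x, y)) ⁻¹' (e.symm ⁻¹' B)} := by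
      ext x
      simp only [Set.mem_preimage, Set.mem_ofPred_eq]
      have : e.symm (x, y) + Pi.single i c = e.symm (x + c, y) := by
        ext j
        refine Fin.succAboveCases i ?_ (fun j => ?_) j
        · simp [hsymm]
        · simp [hsymm]
      rw [this]
    rw [hs]
    obtain rfl | rfl := hc
    · exact tlap_shift_le hε hδ hδ' hm
    · exact tlap_shift_neg_le hε hδ hδ' hm
  refine (lintegral_mono h1).trans ?_
  rw [lintegral_add_right _ measurable_const, lintegral_const_mul, lintegral_const, measure_univ,
    mul_one]
  exact measurable_measure_prodMk_right (e.symm.measurable hB)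

/-! ### Assignment of points to filters -/

lemma IsArgmax.unique {d m : ℕ} {a : Fin m → Vec d} {x : Vec d} {i j : Fin m}
    (hi : IsArgmax a x i) (hj : IsArgmax a x j) : i = j := by
  rcases lt_trichotomy i j with h | h | h
  · exact absurd (hj.2 i h) (not_lt.2 (hi.1 j))
  · exact h
  · exact absurd (hi.2 j h) (not_lt.2 (hj.1 i))

lemma exists_isArgmax {d m : ℕ} (hm : 0 < m) (a : Fin m → Vec d) (x : Vec d) :
    ∃ i, IsArgmax a x i := by
  classical
  have : Nonempty (Fin m) := ⟨⟨0, hm⟩⟩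
  have hne : (Finset.univ.filter fun i => ∀ j, ⟪a j, x⟫ ≤ ⟪a i, x⟫).Nonempty := by
    obtain ⟨i, -, hi⟩ := Finset.exists_max_image Finset.univ (fun i => ⟪a i, x⟫)
      Finset.univ_nonempty
    exact ⟨i, by simpa using hi⟩
  refine ⟨Finset.min' _ hne, (Finset.mem_filter.1 (Finset.min'_mem _ hne)).2, fun j hj => ?_⟩
  by_contra h
  push Not at h
  refine absurd (Finset.min'_le _ j (Finset.mem_filter.2 ⟨Finset.mem_univ _, fun k => ?_⟩))
    (not_le.2 hj)
  exact ((Finset.mem_filter.1 (Finset.min'_mem _ hne)).2 k).trans h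

/-- The filters given by their coordinates. -/
def toFilters {d m : ℕ} (g : Fin m → Fin d → ℝ) : Fin m → Vec d := fun k => WithLp.toLp 2 (g k)

lemma measurable_inner_toFilters {d m : ℕ} (x : Vec d) (i : Fin m) :
    Measurable fun g : Fin m → Fin d → ℝ => ⟪toFilters g i, x⟫ := by
  unfold toFilters
  simp only [PiLp.inner_apply]
  fun_prop

lemma measurableSet_isArgmax {d m : ℕ} (x : Vec d) (i : Fin m) :
    MeasurableSet {g : Fin m → Fin d → ℝ | IsArgmax (toFilters g) x i} := by
  have h : {g : Fin m → Fin d → ℝ | IsArgmax (toFilters g) x i} =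
      (⋂ j, {g | ⟪toFilters g j, x⟫ ≤ ⟪toFilters g i, x⟫}) ∩
        ⋂ j, ⋂ (_ : j < i), {g | ⟪toFilters g j, x⟫ < ⟪toFilters g i, x⟫} := by
    ext g
    simp [IsArgmax]
  rw [h]
  exact (MeasurableSet.iInter fun j => measurableSet_le (measurable_inner_toFilters x j)
    (measurable_inner_toFilters x i)).inter (MeasurableSet.iInter fun j =>
      MeasurableSet.iInter fun _ => measurableSet_lt (measurable_inner_toFilters x j)
        (measurable_inner_toFilters x i))

open Classical in
-- In `bucketCount` the filter runs over vectors: `S` is coerced elementwise through the monad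
-- structure of `Multiset`. This unfolds to the image under `Subtype.val`, which keeps
-- multiplicities. `ballCount_map` unfolds the same coercion.
lemma bucketCount_eq {d m : ℕ} (a : Fin m → Vec d) (S : Multiset (Sph d)) (i : Fin m) :
    bucketCount a S i = ((S.map (Subtype.val : Sph d → Vec d)).filter fun x => IsArgmax a x i).card := by
  unfold bucketCount
  simp only [Multiset.pure_def, Multiset.bind_def, Multiset.bind_singleton]

lemma bucketCount_cons {d m : ℕ} (a : Fin m → Vec d) (S : Multiset (Sph d)) (x : Sph d)
    (i : Fin m) [Decidable (IsArgmax a (x : Vec d) i)] :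
    bucketCount a (x ::ₘ S) i = bucketCount a S i + if IsArgmax a (x : Vec d) i then 1 else 0 := by
  classical
  rw [bucketCount_eq, bucketCount_eq, Multiset.map_cons]
  split_ifs with h
  · rw [Multiset.filter_cons_of_pos (p := fun x : Vec d => IsArgmax a x i) _ h,
      Multiset.card_cons]
  · rw [Multiset.filter_cons_of_neg (p := fun x : Vec d => IsArgmax a x i) _ h, add_zero]

lemma measurable_bucketCount {d m : ℕ} (S : Multiset (Sph d)) (i : Fin m) :
    Measurable fun g : Fin m → Fin d → ℝ => (bucketCount (toFilters g) S i : ℝ) := by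
  classical
  induction S using Multiset.induction with
  | empty => simp [bucketCount]
  | cons x S ih =>
    simp only [bucketCount_cons, Nat.cast_add, Nat.cast_ite, Nat.cast_one, Nat.cast_zero]
    exact ih.add (Measurable.ite (measurableSet_isArgmax _ i) measurable_const measurable_const)

lemma measurable_build {d : ℕ} (n : ℕ) (α β ε δ : ℝ) (S : Multiset (Sph d)) :
    Measurable fun ω : (Fin (numFilters n α β) → Fin d → ℝ) × (Fin (numFilters n α β) → ℝ) =>
      build n α β ε δ S ω.1 ω.2 := by
  refine measurable_comap_iff.2 (Measurable.prodMk ?_ (Measurable.prodMk ?_ measurable_const))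
  · refine measurable_pi_lambda _ fun i => ?_
    have h : Measurable fun ω : (Fin (numFilters n α β) → Fin d → ℝ) ×
        (Fin (numFilters n α β) → ℝ) => (bucketCount (toFilters ω.1) S i : ℝ) + ω.2 i :=
      ((measurable_bucketCount S i).comp measurable_fst).add
        ((measurable_pi_apply i).comp measurable_snd)
    exact Measurable.ite (measurableSet_le h measurable_const) measurable_const h
  · refine measurable_pi_lambda _ fun i => ?_
    exact (WithLp.measurable_toLp 2 _).comp ((measurable_pi_apply i).comp measurable_fst)

/-! ### Privacy -/

lemma isProbabilityMeasure_drawLaw (d m : ℕ) {ε δ : ℝ} (hε : 0 < ε) (hδ : 0 < δ)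
    (hδ' : δ < 1 / 2) : IsProbabilityMeasure (drawLaw d m ε δ) := by
  have := isProbabilityMeasure_tlap hε hδ hδ'
  unfold drawLaw
  infer_instance

lemma build_eq_of_bucketCount {d : ℕ} (n : ℕ) (α β ε δ : ℝ) (S S' : Multiset (Sph d))
    (g : Fin (numFilters n α β) → Fin d → ℝ) (z c : Fin (numFilters n α β) → ℝ)
    (h : ∀ i, (bucketCount (toFilters g) S i : ℝ) = bucketCount (toFilters g) S' i + c i) :
    build n α β ε δ S g z = build n α β ε δ S' g (z + c) := by
  have h' : ∀ i, (bucketCount (toFilters g) S i : ℝ) + z i =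
      bucketCount (toFilters g) S' i + (z + c) i := fun i => by
    rw [h, Pi.add_apply]; ring
  unfold toFilters at h'
  simp only [build, h']

/-- The bucket of the extra point depends on the filters alone, so the change of its counter can be
moved into the noise before truncation takes place. -/
lemma exists_build_shift {d : ℕ} (n : ℕ) (α β ε δ : ℝ) {S S' : Multiset (Sph d)}
    (hS : Neighbouring S S') (hm : 0 < numFilters n α β)
    (g : Fin (numFilters n α β) → Fin d → ℝ) :
    ∃ i, ∃ c : ℝ, (c = 1 ∨ c = -1) ∧ ∀ z,
      build n α β ε δ S g z = build n α β ε δ S' g (z + Pi.single i c) := by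
  classical
  obtain ⟨x, hx⟩ := hS
  obtain ⟨i, hi⟩ := exists_isArgmax hm (toFilters g) (x : Vec d)
  have key : ∀ (S : Multiset (Sph d)) j, (bucketCount (toFilters g) (x ::ₘ S) j : ℝ) =
      bucketCount (toFilters g) S j + (Pi.single i 1 : Fin (numFilters n α β) → ℝ) j := by
    intro S j
    rw [bucketCount_cons]
    by_cases h : j = i
    · subst h; simp [hi]
    · rw [if_neg fun hj => h (hj.unique hi)]; simp [h]
  obtain rfl | rfl := hx
  · refine ⟨i, -1, Or.inr rfl, fun z => build_eq_of_bucketCount n α β ε δ _ _ g z _ fun j => ?_⟩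
    rw [key, Pi.single_neg, Pi.neg_apply]; ring
  · exact ⟨i, 1, Or.inl rfl, fun z => build_eq_of_bucketCount n α β ε δ _ _ g z _ (key S')⟩

theorem construction_isDP {d : ℕ} (n : ℕ) (α β : ℝ) {ε δ : ℝ} (hε : 0 < ε) (hδ : 0 < δ)
    (hδ' : δ < 1 / 2) : IsDP ε δ fun S : Multiset (Sph d) => construction n α β ε δ S := by
  intro S S' hS Y hY
  have := isProbabilityMeasure_tlap hε hδ hδ'
  have hmeas := fun S : Multiset (Sph d) => measurable_build n α β ε δ S
  simp only [construction]
  rw [Measure.map_apply (hmeas S) hY, Measure.map_apply (hmeas S') hY, drawLaw,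
    Measure.prod_apply (hmeas S hY), Measure.prod_apply (hmeas S' hY)]
  have h1 : ∀ g : Fin (numFilters n α β) → Fin d → ℝ,
      (Measure.pi fun _ => tlap 1 ε δ)
        (Prod.mk g ⁻¹' ((fun ω : (Fin (numFilters n α β) → Fin d → ℝ) ×
          (Fin (numFilters n α β) → ℝ) => build n α β ε δ S ω.1 ω.2) ⁻¹' Y)) ≤
      ENNReal.ofReal (Real.exp ε) * (Measure.pi fun _ => tlap 1 ε δ)
        (Prod.mk g ⁻¹' ((fun ω : (Fin (numFilters n α β) → Fin d → ℝ) ×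
          (Fin (numFilters n α β) → ℝ) => build n α β ε δ S' ω.1 ω.2) ⁻¹' Y)) +
        ENNReal.ofReal δ := by
    intro g
    have hB : MeasurableSet (Prod.mk g ⁻¹' ((fun ω : (Fin (numFilters n α β) → Fin d → ℝ) ×
          (Fin (numFilters n α β) → ℝ) => build n α β ε δ S' ω.1 ω.2) ⁻¹' Y)) :=
      measurable_prodMk_left (hmeas S' hY)
    -- Without filters (possible for n = 0, where a power of 0 is rounded up) the output does not
    -- depend on the dataset.
    rcases Nat.eq_zero_or_pos (numFilters n α β) with hm | hm
    · have : ∀ z, build n α β ε δ S g z = build n α β ε δ S' g z := fun z => by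
        rw [build_eq_of_bucketCount n α β ε δ S S' g z 0
          fun i => absurd (i.2.trans_eq hm) (Nat.not_lt_zero _), add_zero]
      refine le_add_right ?_
      simp only [Set.preimage, Set.mem_ofPred_eq, this]
      refine le_mul_of_one_le_left zero_le ?_
      rw [← ENNReal.ofReal_one]
      exact ENNReal.ofReal_le_ofReal (Real.one_le_exp hε.le)
    · obtain ⟨i, c, hc, hb⟩ := exists_build_shift n α β ε δ hS hm g
      refine le_trans (le_of_eq ?_) (pi_tlap_shift_le hε hδ hδ' i hc hB)
      congr 1
      ext z
      simp only [Set.mem_preimage, Set.mem_ofPred_eq, hb]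
  refine (lintegral_mono h1).trans ?_
  rw [lintegral_add_right _ measurable_const, lintegral_const_mul, lintegral_const, measure_univ,
    mul_one]
  exact measurable_measure_prodMk_left (hmeas S' hY)

theorem isProbabilityMeasure_construction {d : ℕ} (n : ℕ) (α β : ℝ) {ε δ : ℝ} (hε : 0 < ε)
    (hδ : 0 < δ) (hδ' : δ < 1 / 2) (S : Multiset (Sph d)) :
    IsProbabilityMeasure (construction n α β ε δ S) := by
  have := isProbabilityMeasure_drawLaw d (numFilters n α β) hε hδ hδ'
  exact Measure.isProbabilityMeasure_map (measurable_build n α β ε δ S).aemeasurable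

/-! ### Gaussian filters -/

/-- The standard Gaussian law on coordinate vectors. -/
abbrev gaussVec (d : ℕ) : Measure (Fin d → ℝ) := Measure.pi fun _ => gaussianReal 0 1

/-- The law of `m` independent standard Gaussian vectors. -/
abbrev gaussFilters (d m : ℕ) : Measure (Fin m → Fin d → ℝ) := Measure.pi fun _ => gaussVec d

lemma measurable_inner_toLp {d : ℕ} (w : Vec d) :
    Measurable fun g : Fin d → ℝ => ⟪(WithLp.toLp 2 g : Vec d), w⟫ := by
  simp only [PiLp.inner_apply]
  fun_prop

lemma map_inner_gaussVec {d : ℕ} (w : Vec d) :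
    (gaussVec d).map (fun g => ⟪(WithLp.toLp 2 g : Vec d), w⟫) =
      gaussianReal 0 (‖w‖ ^ 2).toNNReal := by
  have h := IsGaussian.map_eq_gaussianReal (μ := stdGaussian (Vec d)) (innerSL ℝ w)
  rw [integral_strongDual_stdGaussian, variance_dual_stdGaussian, innerSL_apply_norm,
    ← map_pi_eq_stdGaussian, Measure.map_map (by fun_prop) (WithLp.measurable_toLp 2 _)] at h
  rw [← h]
  congr 1
  ext g
  simp [real_inner_comm]

lemma gaussVec_inner_ge_le {d : ℕ} (w : Vec d) (t : ℝ) :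
    (gaussVec d).real {g | t ≤ ⟪(WithLp.toLp 2 g : Vec d), w⟫} ≤
      Real.exp (-t + ‖w‖ ^ 2 / 2) := by
  have hm := measurable_inner_toLp w
  have hint : Integrable (fun g : Fin d → ℝ =>
      Real.exp (1 * ⟪(WithLp.toLp 2 g : Vec d), w⟫)) (gaussVec d) := by
    have h := integrable_exp_mul_gaussianReal (μ := 0) (v := (‖w‖ ^ 2).toNNReal) 1
    rw [← map_inner_gaussVec w] at h
    exact h.comp_measurable hm
  have h := measure_ge_le_exp_mul_mgf t zero_le_one hint
  rw [mgf_gaussianReal (map_inner_gaussVec w), Real.coe_toNNReal _ (sq_nonneg _),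
    ← Real.exp_add] at h
  convert h using 2
  ring

/-- Chernoff bound for two correlated standard Gaussians. -/
lemma gaussVec_inner_ge_inner_ge_le {d : ℕ} {x q : Vec d} (hx : ‖x‖ = 1) (hq : ‖q‖ = 1)
    {r M t : ℝ} (hr : ⟪x, q⟫ ≤ r) (hr1 : r ^ 2 < 1) (hM : 0 ≤ M) (hrt : r * t ≤ M) :
    (gaussVec d).real {g | M ≤ ⟪(WithLp.toLp 2 g : Vec d), x⟫ ∧
        t ≤ ⟪(WithLp.toLp 2 g : Vec d), q⟫} ≤
      Real.exp (-(M ^ 2 / 2) - max 0 (t - r * M) ^ 2 / (2 * (1 - r ^ 2))) := by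
  -- Exponential Markov inequality for l⟪g,x⟫ + u⟪g,q⟫. Since lu ≥ 0, its variance may be bounded by
  -- putting r in place of ⟪x,q⟫.
  have key : ∀ l u : ℝ, 0 ≤ l → 0 ≤ u →
      (gaussVec d).real {g | M ≤ ⟪(WithLp.toLp 2 g : Vec d), x⟫ ∧
        t ≤ ⟪(WithLp.toLp 2 g : Vec d), q⟫} ≤
      Real.exp (-(l * M + u * t) + (l ^ 2 + u ^ 2 + 2 * (l * u) * r) / 2) := by
    intro l u hl hu
    refine (measureReal_mono ?_ (measure_ne_top _ _)).trans
      ((gaussVec_inner_ge_le (l • x + u • q) (l * M + u * t)).trans ?_)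
    · rintro g ⟨h1, h2⟩
      change l * M + u * t ≤ _
      rw [inner_add_right, inner_smul_right, inner_smul_right]
      exact add_le_add (mul_le_mul_of_nonneg_left h1 hl) (mul_le_mul_of_nonneg_left h2 hu)
    · refine Real.exp_le_exp.2 ?_
      have : ‖l • x + u • q‖ ^ 2 = l ^ 2 + u ^ 2 + 2 * (l * u) * ⟪x, q⟫ := by
        rw [norm_add_sq_real, norm_smul, norm_smul, hx, hq, inner_smul_left, inner_smul_right]
        simp only [Real.norm_eq_abs, mul_one, sq_abs, conj_trivial]
        ring
      rw [this]
      have := mul_le_mul_of_nonneg_left hr (mul_nonneg hl hu)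
      linarith
  have hs : 0 < 1 - r ^ 2 := by linarith
  rcases le_total (t - r * M) 0 with h | h
  · refine (key M 0 hM le_rfl).trans (Real.exp_le_exp.2 (le_of_eq ?_))
    rw [max_eq_left h]; ring
  -- The optimal multipliers: the inverse covariance matrix applied to (M, t). `hrt` and `h` make
  -- them nonnegative; in the other case the constraint t is slack and u = 0 is used.
  · refine (key ((M - r * t) / (1 - r ^ 2)) ((t - r * M) / (1 - r ^ 2))
      (div_nonneg (by linarith) hs.le) (div_nonneg h hs.le)).trans
      (Real.exp_le_exp.2 (le_of_eq ?_))
    rw [max_eq_right h]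
    field_simp
    ring

/-- On [M, M + 1/M] the exponent t²/2 exceeds M²/2 by at most 3/2, so the density there is at least
e^(-3/2)/√(2π) ≥ 1/15 times e^(-M²/2), and the interval has length 1/M. -/
lemma gaussianReal_Ici_ge {M : ℝ} (hM : 1 ≤ M) :
    1 / 16 * (Real.exp (-(M ^ 2 / 2)) / M) ≤ (gaussianReal 0 1).real {t | M ≤ t} := by
  have hM0 : 0 < M := by linarith
  set c : ℝ := 1 / 16 * Real.exp (-(M ^ 2 / 2)) with hc
  have hsub : Set.Icc M (M + 1 / M) ⊆ {t | M ≤ t} := fun t ht => ht.1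
  have hpdf : ∀ t ∈ Set.Icc M (M + 1 / M), ENNReal.ofReal c ≤ gaussianPDF 0 1 t := by
    intro t ht
    refine ENNReal.ofReal_le_ofReal ?_
    rw [gaussianPDFReal, hc]
    simp only [NNReal.coe_one, mul_one, sub_zero]
    have h1 : t ^ 2 ≤ M ^ 2 + 3 := by
      have h2 : t ^ 2 ≤ (M + 1 / M) ^ 2 := pow_le_pow_left₀ (hM0.le.trans ht.1) ht.2 2
      have h3 : (M + 1 / M) ^ 2 = M ^ 2 + 2 + (1 / M) ^ 2 := by field_simp; ring
      have h4 : (1 / M) ^ 2 ≤ 1 := pow_le_one₀ (by positivity) (by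
        rw [div_le_one hM0]; exact hM)
      linarith
    have h2 : Real.exp (-(3 / 2)) * Real.exp (-(M ^ 2 / 2)) ≤ Real.exp (-t ^ 2 / 2) := by
      rw [← Real.exp_add]; exact Real.exp_le_exp.2 (by linarith)
    have h3 : √(2 * Real.pi) ≤ 3 := by
      rw [Real.sqrt_le_left (by norm_num)]; linarith [Real.pi_lt_d2]
    have h4 : Real.exp (3 / 2) ≤ 5 := by
      have h5 : Real.exp (3 / 2) ^ 2 ≤ 5 ^ 2 := by
        rw [← Real.exp_nat_mul]
        have h6 : Real.exp ((2 : ℕ) * (3 / 2)) = Real.exp 1 ^ 3 := by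
          rw [← Real.exp_nat_mul]; norm_num
        rw [h6]
        have h7 : Real.exp 1 ^ 3 ≤ 2.8 ^ 3 :=
          pow_le_pow_left₀ (Real.exp_pos _).le (by linarith [Real.exp_one_lt_d9]) 3
        norm_num at h7 ⊢
        linarith
      exact le_of_sq_le_sq h5 (by norm_num)
    have h5 : (1 : ℝ) / 5 ≤ Real.exp (-(3 / 2)) := by
      rw [Real.exp_neg, one_div]
      exact inv_anti₀ (Real.exp_pos _) h4
    have h6 : (1 : ℝ) / 3 ≤ (√(2 * Real.pi))⁻¹ := by
      rw [one_div]
      exact inv_anti₀ (Real.sqrt_pos.2 (by positivity)) h3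
    calc 1 / 16 * Real.exp (-(M ^ 2 / 2)) ≤ 1 / 3 * (1 / 5 * Real.exp (-(M ^ 2 / 2))) := by
          have := Real.exp_pos (-(M ^ 2 / 2)); linarith
      _ ≤ (√(2 * Real.pi))⁻¹ * (Real.exp (-(3 / 2)) * Real.exp (-(M ^ 2 / 2))) := by gcongr
      _ ≤ _ := by gcongr
  have h := setLIntegral_mono_ae (μ := volume) (s := Set.Icc M (M + 1 / M))
    (f := fun _ => ENNReal.ofReal c) (measurable_gaussianPDF 0 1).aemeasurable
    (Eventually.of_forall hpdf)
  rw [setLIntegral_const, Real.volume_Icc, ← gaussianReal_apply 0 one_ne_zero,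
    ← ENNReal.ofReal_mul (by positivity)] at h
  rw [Measure.real, ← ENNReal.ofReal_le_iff_le_toReal (measure_ne_top _ _)]
  refine le_trans (le_of_eq ?_) (h.trans (measure_mono hsub))
  congr 1
  rw [hc]; ring

lemma gaussVec_inner_ge_ge {d : ℕ} {x : Vec d} (hx : ‖x‖ = 1) {M : ℝ} (hM : 1 ≤ M) :
    1 / 16 * (Real.exp (-(M ^ 2 / 2)) / M) ≤
      (gaussVec d).real {g | M ≤ ⟪(WithLp.toLp 2 g : Vec d), x⟫} := by
  refine (gaussianReal_Ici_ge hM).trans (le_of_eq ?_)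
  have h := map_inner_gaussVec x
  rw [hx, one_pow, Real.toNNReal_one] at h
  have hms : MeasurableSet {t : ℝ | M ≤ t} := measurableSet_Ici
  rw [← h, map_measureReal_apply (measurable_inner_toLp x) hms]
  rfl

lemma gaussFilters_real_eval {d m : ℕ} (i : Fin m) {s : Set (Fin d → ℝ)} (hs : MeasurableSet s) :
    (gaussFilters d m).real {g | g i ∈ s} = (gaussVec d).real s :=
  (measurePreserving_eval (fun _ : Fin m => gaussVec d) i).measureReal_preimage hs.nullMeasurableSet

lemma gaussFilters_max_lt_le {d m : ℕ} {x : Vec d} (hx : ‖x‖ = 1) {M : ℝ} (hM : 1 ≤ M) :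
    (gaussFilters d m).real {g | ∀ i, ⟪toFilters g i, x⟫ < M} ≤
      Real.exp (-(m * (1 / 16 * (Real.exp (-(M ^ 2 / 2)) / M)))) := by
  have hset : {g : Fin m → Fin d → ℝ | ∀ i, ⟪toFilters g i, x⟫ < M} =
      Set.univ.pi fun _ => {g : Fin d → ℝ | M ≤ ⟪(WithLp.toLp 2 g : Vec d), x⟫}ᶜ := by
    ext g
    simp [toFilters]
  have hms : MeasurableSet {g : Fin d → ℝ | M ≤ ⟪(WithLp.toLp 2 g : Vec d), x⟫} :=
    measurable_inner_toLp x measurableSet_Ici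
  rw [hset, Measure.real, Measure.pi_pi, Finset.prod_const, Finset.card_univ, Fintype.card_fin,
    ENNReal.toReal_pow, ← Measure.real, probReal_compl_eq_one_sub hms, neg_mul_eq_mul_neg,
    Real.exp_nat_mul]
  refine pow_le_pow_left₀ (sub_nonneg.2 measureReal_le_one) ?_ m
  refine le_trans ?_ (Real.one_sub_le_exp_neg _)
  linarith [gaussVec_inner_ge_ge hx hM]

/-- The probability that the filter to which `x` is assigned has a large inner product with `q`. -/
lemma gaussFilters_argmax_le {d m : ℕ} {x q : Vec d} (hx : ‖x‖ = 1) (hq : ‖q‖ = 1)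
    {r M t : ℝ} (hr : ⟪x, q⟫ ≤ r) (hr1 : r ^ 2 < 1) (hM : 1 ≤ M) (hrt : r * t ≤ M) :
    (gaussFilters d m).real {g | ∃ i, IsArgmax (toFilters g) x i ∧ t ≤ ⟪toFilters g i, q⟫} ≤
      Real.exp (-(m * (1 / 16 * (Real.exp (-(M ^ 2 / 2)) / M)))) +
      m * Real.exp (-(M ^ 2 / 2) - max 0 (t - r * M) ^ 2 / (2 * (1 - r ^ 2))) := by
  have hsub : {g : Fin m → Fin d → ℝ | ∃ i, IsArgmax (toFilters g) x i ∧
      t ≤ ⟪toFilters g i, q⟫} ⊆ {g | ∀ i, ⟪toFilters g i, x⟫ < M} ∪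
        ⋃ i, {g | g i ∈ {g : Fin d → ℝ | M ≤ ⟪(WithLp.toLp 2 g : Vec d), x⟫ ∧
          t ≤ ⟪(WithLp.toLp 2 g : Vec d), q⟫}} := by
    rintro g ⟨i, hi, ht⟩
    -- If any filter reaches M, so does the maximizing one.
    by_cases h : ∀ i, ⟪toFilters g i, x⟫ < M
    · exact Or.inl h
    · push Not at h
      obtain ⟨j, hj⟩ := h
      exact Or.inr (Set.mem_iUnion.2 ⟨i, hj.trans (hi.1 j), ht⟩)
  have hms : MeasurableSet {g : Fin d → ℝ | M ≤ ⟪(WithLp.toLp 2 g : Vec d), x⟫ ∧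
      t ≤ ⟪(WithLp.toLp 2 g : Vec d), q⟫} :=
    (measurable_inner_toLp x measurableSet_Ici).inter (measurable_inner_toLp q measurableSet_Ici)
  refine (measureReal_mono hsub (measure_ne_top _ _)).trans
    ((measureReal_union_le _ _).trans (add_le_add (gaussFilters_max_lt_le hx hM)
      ((measureReal_iUnion_fintype_le _).trans ?_)))
  refine (Finset.sum_le_card_nsmul _ _
    (Real.exp (-(M ^ 2 / 2) - max 0 (t - r * M) ^ 2 / (2 * (1 - r ^ 2)))) fun i _ => ?_).trans
    (le_of_eq ?_)
  · rw [gaussFilters_real_eval i hms]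
    exact gaussVec_inner_ge_inner_ge_le hx hq hr hr1 (by linarith) hrt
  · simp

lemma gaussFilters_inner_ge_le {d m : ℕ} {q : Vec d} (hq : ‖q‖ = 1) (t : ℝ) (i : Fin m) :
    (gaussFilters d m).real {g | t ≤ ⟪toFilters g i, q⟫} ≤ Real.exp (-(max 0 t ^ 2 / 2)) := by
  have h := gaussFilters_real_eval (m := m) i
    (measurable_inner_toLp q (measurableSet_Ici (a := t)))
  refine h.le.trans ?_
  rcases le_total t 0 with ht | ht
  · rw [max_eq_left ht]; simp [measureReal_le_one]
  · rw [max_eq_right ht]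
    refine (measureReal_mono ?_ (measure_ne_top _ _)).trans
      ((gaussVec_inner_ge_le (t • q) (t * t)).trans (le_of_eq ?_))
    · intro g hg
      change t * t ≤ ⟪(WithLp.toLp 2 g : Vec d), t • q⟫
      rw [inner_smul_right]
      exact mul_le_mul_of_nonneg_left hg ht
    · rw [norm_smul, hq, mul_one, Real.norm_eq_abs, sq_abs]; ring_nf

/-! ### Counting bad events -/

open Classical in
/-- Markov's inequality for the number of events that occur. -/
lemma measure_card_gt_le {Ω ι : Type*} [MeasurableSpace Ω] (μ : Measure Ω) (s : Finset ι)
    {E : ι → Set Ω} (hE : ∀ k ∈ s, MeasurableSet (E k)) {c : ℝ}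
    (hc : ∑ k ∈ s, μ (E k) ≤ ENNReal.ofReal c) (hc0 : 0 ≤ c) :
    μ {ω | 9 * c < ((s.filter fun k => ω ∈ E k).card : ℝ)} ≤ 1 / 9 := by
  set f : Ω → ℝ≥0∞ := fun ω => ∑ k ∈ s, (E k).indicator 1 ω with hf
  have hfm : Measurable f := Finset.measurable_fun_sum _ fun k hk =>
    measurable_one.indicator (hE k hk)
  have hfi : ∫⁻ ω, f ω ∂μ = ∑ k ∈ s, μ (E k) := by
    rw [hf, lintegral_finsetSum _ fun k hk => measurable_one.indicator (hE k hk)]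
    exact Finset.sum_congr rfl fun k hk => lintegral_indicator_one (hE k hk)
  have hfc : ∀ ω, f ω = ENNReal.ofReal ((s.filter fun k => ω ∈ E k).card : ℝ) := by
    intro ω
    rw [ENNReal.ofReal_natCast, Finset.card_filter]
    push_cast
    refine Finset.sum_congr rfl fun k _ => ?_
    by_cases h : ω ∈ E k <;> simp [h]
  -- For c = 0 one cannot divide by c, but then almost surely none of the events occurs.
  rcases hc0.eq_or_lt with rfl | hpos
  · rw [ENNReal.ofReal_zero, nonpos_iff_eq_zero, ← hfi, lintegral_eq_zero_iff hfm] at hc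
    refine le_of_eq_of_le (measure_mono_null (fun ω hω => ?_) (ae_iff.1 hc)) zero_le
    change ¬ f ω = 0
    have hω' : 9 * 0 < ((s.filter fun k => ω ∈ E k).card : ℝ) := hω
    rw [hfc, ENNReal.ofReal_eq_zero]
    linarith
  · have h := mul_meas_ge_le_lintegral (μ := μ) hfm (ENNReal.ofReal (9 * c))
    rw [hfi] at h
    have h2 := h.trans hc
    rw [ENNReal.ofReal_mul (by norm_num), mul_comm (ENNReal.ofReal 9), mul_assoc] at h2
    have hne : ENNReal.ofReal c ≠ 0 := (ENNReal.ofReal_pos.2 hpos).ne'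
    have h3 : ENNReal.ofReal 9 * μ {x | ENNReal.ofReal c * ENNReal.ofReal 9 ≤ f x} ≤ 1 := by
      rwa [← ENNReal.mul_le_mul_iff_right hne ENNReal.ofReal_ne_top, mul_one]
    rw [ENNReal.le_div_iff_mul_le (by simp) (by simp), mul_comm]
    refine le_trans (mul_le_mul' (by simp) (measure_mono fun ω hω => ?_)) h3
    change _ ≤ f ω
    rw [hfc, ← ENNReal.ofReal_mul hpos.le]
    refine ENNReal.ofReal_le_ofReal ?_
    have : 9 * c < _ := hω
    linarith

/-! ### Datasets as families of points -/

lemma exists_eq_map_univ {X : Type*} (S : Multiset X) {n : ℕ} (hS : S.card = n) :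
    ∃ x : Fin n → X, S = Finset.univ.val.map x := by
  subst hS
  obtain ⟨l, rfl⟩ := Quot.exists_rep S
  refine ⟨l.get, ?_⟩
  change (l : Multiset X) = Multiset.map l.get (Finset.univ : Finset (Fin l.length)).val
  rw [Fin.univ_val_map, List.ofFn_get]

open Classical in
lemma bucketCount_map {d m n : ℕ} (a : Fin m → Vec d) (x : Fin n → Sph d) (i : Fin m) :
    bucketCount a (Finset.univ.val.map x) i =
      (Finset.univ.filter fun k => IsArgmax a (x k : Vec d) i).card := by
  rw [bucketCount_eq, Multiset.map_map, Multiset.filter_map, Multiset.card_map]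
  rfl

open Classical in
lemma ballCount_map {d n : ℕ} (x : Fin n → Sph d) (q : Sph d) (r : ℝ) :
    ballCount (Finset.univ.val.map x) q r =
      (Finset.univ.filter fun k => r ≤ ⟪(q : Vec d), (x k : Vec d)⟫).card := by
  unfold ballCount
  simp only [Multiset.pure_def, Multiset.bind_def, Multiset.bind_singleton]
  rw [Multiset.map_map, Multiset.filter_map, Multiset.card_map]
  rfl

/-! ### The query answer for given draws -/

section QueryBounds

variable {d m n : ℕ} (a : Fin m → Vec d) (x : Fin n → Sph d) (q : Sph d) (t : ℝ)

open Classical in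
-- Double counting: the buckets are disjoint, since a point has only one first maximizer.
lemma sum_bucketCount_eq :
    ∑ i with t ≤ ⟪a i, (q : Vec d)⟫, bucketCount a (Finset.univ.val.map x) i =
      (Finset.univ.filter fun k =>
        ∃ i, IsArgmax a (x k : Vec d) i ∧ t ≤ ⟪a i, (q : Vec d)⟫).card := by
  simp only [bucketCount_map, Finset.card_filter]
  rw [Finset.sum_comm]
  refine Finset.sum_congr rfl fun k _ => ?_
  split_ifs with h
  · obtain ⟨i, hi, hq⟩ := h
    rw [Finset.sum_eq_single_of_mem i (by simpa using hq), if_pos hi]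
    exact fun j _ hj => if_neg fun hj' => hj (hj'.unique hi)
  · refine Finset.sum_eq_zero fun i hi => if_neg fun h' => h ⟨i, h', ?_⟩
    simpa using hi

open Classical in
lemma sum_bucketCount_le (β : ℝ) :
    ∑ i with t ≤ ⟪a i, (q : Vec d)⟫, bucketCount a (Finset.univ.val.map x) i ≤
      ballCount (Finset.univ.val.map x) q β +
        ((Finset.univ.filter fun k => ¬ β ≤ ⟪(q : Vec d), (x k : Vec d)⟫).filter fun k =>
          ∃ i, IsArgmax a (x k : Vec d) i ∧ t ≤ ⟪a i, (q : Vec d)⟫).card := by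
  rw [sum_bucketCount_eq, ballCount_map]
  refine le_trans (Finset.card_le_card fun k hk => ?_) (Finset.card_union_le _ _)
  by_cases h : β ≤ ⟪(q : Vec d), (x k : Vec d)⟫
  · exact Finset.mem_union_left _ (by simpa using h)
  · exact Finset.mem_union_right _ (Finset.mem_filter.2 ⟨by simpa using h, by simpa using hk⟩)

open Classical in
-- A miss is expressed through -q and -t, so that the same upper bound `gaussFilters_argmax_le`
-- serves for missed near points and for found far points.
lemma le_sum_bucketCount (hm : 0 < m) (α : ℝ) :
    ballCount (Finset.univ.val.map x) q α ≤
      ∑ i with t ≤ ⟪a i, (q : Vec d)⟫, bucketCount a (Finset.univ.val.map x) i +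
        ((Finset.univ.filter fun k => α ≤ ⟪(q : Vec d), (x k : Vec d)⟫).filter fun k =>
          ∃ i, IsArgmax a (x k : Vec d) i ∧ -t ≤ ⟪a i, -(q : Vec d)⟫).card := by
  rw [sum_bucketCount_eq, ballCount_map]
  refine le_trans (Finset.card_le_card fun k hk => ?_) (Finset.card_union_le _ _)
  obtain ⟨i, hi⟩ := exists_isArgmax hm a (x k : Vec d)
  by_cases h : t ≤ ⟪a i, (q : Vec d)⟫
  · exact Finset.mem_union_left _ (by simpa using ⟨i, hi, h⟩)
  · refine Finset.mem_union_right _ (Finset.mem_filter.2 ⟨hk, i, hi, ?_⟩)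
    rw [inner_neg_right]
    linarith

end QueryBounds

open Classical in
-- A surviving counter is off by its noise, at most A. A counter set to 0 had noisy value at most A,
-- hence true value at most 2A.
lemma abs_query_build_sub_le {d n : ℕ} {α β ε δ : ℝ} (S : Multiset (Sph d)) (q : Sph d)
    (g : Fin (numFilters n α β) → Fin d → ℝ) (z : Fin (numFilters n α β) → ℝ)
    (hz : ∀ i, |z i| ≤ tlapRadius 1 ε δ) :
    |(build n α β ε δ S g z).query q -
      (∑ i with threshold (numFilters n α β) α ≤ ⟪toFilters g i, (q : Vec d)⟫,
        bucketCount (toFilters g) S i : ℕ)| ≤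
      (Finset.univ.filter fun i =>
        threshold (numFilters n α β) α ≤ ⟪toFilters g i, (q : Vec d)⟫).card *
          (2 * tlapRadius 1 ε δ) := by
  have h : (build n α β ε δ S g z).query q =
      ∑ i with threshold (numFilters n α β) α ≤ ⟪toFilters g i, (q : Vec d)⟫,
        (build n α β ε δ S g z).table i := rfl
  rw [h, Nat.cast_sum, ← Finset.sum_sub_distrib, ← nsmul_eq_mul]
  refine (Finset.abs_sum_le_sum_abs _ _).trans (Finset.sum_le_card_nsmul _ _ _ fun i _ => ?_)
  have hi := abs_le.1 (hz i)
  have hT : (0 : ℝ) ≤ bucketCount (toFilters g) S i := Nat.cast_nonneg _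
  have ht : (build n α β ε δ S g z).table i =
    if (bucketCount (toFilters g) S i : ℝ) + z i ≤ tlapRadius 1 ε δ then 0
    else (bucketCount (toFilters g) S i : ℝ) + z i := rfl
  rw [ht, abs_le]
  split_ifs with hif
  · constructor <;> linarith
  · constructor <;> linarith

lemma ae_drawLaw_abs_le {d m : ℕ} {ε δ : ℝ} (hε : 0 < ε) (hδ : 0 < δ) (hδ' : δ < 1 / 2) :
    ∀ᵐ ω ∂drawLaw d m ε δ, ∀ i, |ω.2 i| ≤ tlapRadius 1 ε δ := by
  have := isProbabilityMeasure_tlap hε hδ hδ'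
  refine ae_all_iff.2 fun i => ?_
  have h1 : MeasurePreserving (fun ω : (Fin m → Fin d → ℝ) × (Fin m → ℝ) => ω.2 i)
      (drawLaw d m ε δ) (tlap 1 ε δ) :=
    (measurePreserving_eval (fun _ : Fin m => tlap 1 ε δ) i).comp measurePreserving_snd
  exact h1.quasiMeasurePreserving.ae ae_tlap_abs_le

lemma drawLaw_fst {d m : ℕ} {ε δ : ℝ} (hε : 0 < ε) (hδ : 0 < δ) (hδ' : δ < 1 / 2)
    {s : Set (Fin m → Fin d → ℝ)} (hs : MeasurableSet s) :
    drawLaw d m ε δ {ω | ω.1 ∈ s} = gaussFilters d m s := by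
  have := isProbabilityMeasure_tlap hε hδ hδ'
  exact (measurePreserving_fst (μ := gaussFilters d m)
    (ν := Measure.pi fun _ : Fin m => tlap 1 ε δ)).measure_preimage hs.nullMeasurableSet

lemma measurableSet_exists_argmax {d m : ℕ} (x q : Vec d) (t : ℝ) :
    MeasurableSet {g : Fin m → Fin d → ℝ |
      ∃ i, IsArgmax (toFilters g) x i ∧ t ≤ ⟪toFilters g i, q⟫} := by
  have h : {g : Fin m → Fin d → ℝ | ∃ i, IsArgmax (toFilters g) x i ∧ t ≤ ⟪toFilters g i, q⟫} =
      ⋃ i, ({g | IsArgmax (toFilters g) x i} ∩ {g | t ≤ ⟪toFilters g i, q⟫}) := by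
    ext g; simp
  rw [h]
  exact MeasurableSet.iUnion fun i => (measurableSet_isArgmax x i).inter
    (measurable_inner_toFilters q i measurableSet_Ici)

/-- Accuracy, given bounds on the probabilities that a filter is queried, that a near point is
missed and that a far point is found. -/
lemma construction_accuracy {d n : ℕ} {α β ε δ : ℝ} (hε : 0 < ε) (hδ : 0 < δ)
    (hδ' : δ < 1 / 2) (hm : 0 < numFilters n α β) (x : Fin n → Sph d) (q : Sph d)
    {pQ pN pF : ℝ} (hpQ0 : 0 ≤ pQ) (hpN0 : 0 ≤ pN) (hpF0 : 0 ≤ pF)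
    (hpQ : ∀ i, (gaussFilters d (numFilters n α β)).real
      {g | threshold (numFilters n α β) α ≤ ⟪toFilters g i, (q : Vec d)⟫} ≤ pQ)
    (hpN : ∀ k, α ≤ ⟪(q : Vec d), (x k : Vec d)⟫ → (gaussFilters d (numFilters n α β)).real
      {g | ∃ i, IsArgmax (toFilters g) (x k) i ∧
        -threshold (numFilters n α β) α ≤ ⟪toFilters g i, -(q : Vec d)⟫} ≤ pN)
    (hpF : ∀ k, ¬ β ≤ ⟪(q : Vec d), (x k : Vec d)⟫ → (gaussFilters d (numFilters n α β)).real
      {g | ∃ i, IsArgmax (toFilters g) (x k) i ∧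
        threshold (numFilters n α β) α ≤ ⟪toFilters g i, (q : Vec d)⟫} ≤ pF) :
    2 / 3 ≤ construction n α β ε δ (Finset.univ.val.map x)
      {D | (1 - 9 * pN) * (ballCount (Finset.univ.val.map x) q α : ℝ) -
            9 * (numFilters n α β * pQ) * (2 * tlapRadius 1 ε δ) ≤ D.query q ∧
          D.query q ≤ (ballCount (Finset.univ.val.map x) q β : ℝ) + 9 * (n * pF) +
            9 * (numFilters n α β * pQ) * (2 * tlapRadius 1 ε δ)} := by
  classical
  have hprob := isProbabilityMeasure_drawLaw d (numFilters n α β) hε hδ hδ'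
  have hA : 0 ≤ tlapRadius 1 ε δ := zero_le_one.trans (one_le_tlapRadius hε hδ hδ')
  -- Only this direction is needed, and it requires no measurability of the event.
  refine le_trans ?_ (Measure.le_map_apply (measurable_build n α β ε δ _).aemeasurable _)
  set m := numFilters n α β with hmdef
  set η := threshold m α with hη
  set μ := drawLaw d m ε δ with hμ
  let EQ : Fin m → Set ((Fin m → Fin d → ℝ) × (Fin m → ℝ)) := fun i =>
    {ω | ω.1 ∈ {g | η ≤ ⟪toFilters g i, (q : Vec d)⟫}}
  let EN : Fin n → Set ((Fin m → Fin d → ℝ) × (Fin m → ℝ)) := fun k =>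
    {ω | ω.1 ∈ {g | ∃ i, IsArgmax (toFilters g) (x k) i ∧ -η ≤ ⟪toFilters g i, -(q : Vec d)⟫}}
  let EF : Fin n → Set ((Fin m → Fin d → ℝ) × (Fin m → ℝ)) := fun k =>
    {ω | ω.1 ∈ {g | ∃ i, IsArgmax (toFilters g) (x k) i ∧ η ≤ ⟪toFilters g i, (q : Vec d)⟫}}
  let sN : Finset (Fin n) := Finset.univ.filter fun k => α ≤ ⟪(q : Vec d), (x k : Vec d)⟫
  let sF : Finset (Fin n) := Finset.univ.filter fun k => ¬ β ≤ ⟪(q : Vec d), (x k : Vec d)⟫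
  have hmeas : ∀ {s : Set (Fin m → Fin d → ℝ)} {p : ℝ}, MeasurableSet s →
      (gaussFilters d m).real s ≤ p → μ {ω | ω.1 ∈ s} ≤ ENNReal.ofReal p := by
    intro s p hs hp
    rw [hμ, drawLaw_fst hε hδ hδ' hs, ← ofReal_measureReal (measure_ne_top _ _)]
    exact ENNReal.ofReal_le_ofReal hp
  have sum_le : ∀ {ι : Type} (s : Finset ι) (E : ι → Set ((Fin m → Fin d → ℝ) × (Fin m → ℝ)))
      (p : ℝ), (∀ k ∈ s, μ (E k) ≤ ENNReal.ofReal p) →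
      ∑ k ∈ s, μ (E k) ≤ ENNReal.ofReal (s.card * p) := by
    intro ι s E p h
    refine (Finset.sum_le_card_nsmul _ _ _ h).trans (le_of_eq ?_)
    rw [nsmul_eq_mul, ENNReal.ofReal_mul (Nat.cast_nonneg _), ENNReal.ofReal_natCast]
  have mQ : ∀ i, MeasurableSet {g : Fin m → Fin d → ℝ | η ≤ ⟪toFilters g i, (q : Vec d)⟫} :=
    fun i => measurable_inner_toFilters _ i measurableSet_Ici
  have bQ := measure_card_gt_le μ Finset.univ (E := EQ) (fun i _ => measurable_fst (mQ i))
    (sum_le _ EQ pQ fun i _ => hmeas (mQ i) (hpQ i)) (by positivity)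
  have bN := measure_card_gt_le μ sN (E := EN)
    (fun k _ => measurable_fst (measurableSet_exists_argmax _ _ _))
    (sum_le _ EN pN fun k hk => hmeas (measurableSet_exists_argmax _ _ _)
      (hpN k (Finset.mem_filter.1 hk).2)) (by positivity)
  have bF := measure_card_gt_le μ sF (E := EF)
    (fun k _ => measurable_fst (measurableSet_exists_argmax _ _ _))
    (sum_le _ EF pF fun k hk => hmeas (measurableSet_exists_argmax _ _ _)
      (hpF k (Finset.mem_filter.1 hk).2)) (by positivity)
  have bz : μ {ω | ¬ ∀ i, |ω.2 i| ≤ tlapRadius 1 ε δ} = 0 :=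
    ae_iff.1 (ae_drawLaw_abs_le hε hδ hδ')
  set good : Set ((Fin m → Fin d → ℝ) × (Fin m → ℝ)) :=
    (fun ω => build n α β ε δ (Finset.univ.val.map x) ω.1 ω.2) ⁻¹'
      {D | (1 - 9 * pN) * (ballCount (Finset.univ.val.map x) q α : ℝ) -
            9 * (m * pQ) * (2 * tlapRadius 1 ε δ) ≤ D.query q ∧
          D.query q ≤ (ballCount (Finset.univ.val.map x) q β : ℝ) + 9 * (n * pF) +
            9 * (m * pQ) * (2 * tlapRadius 1 ε δ)} with hgood
  set BQ := {ω | 9 * ((Finset.univ : Finset (Fin m)).card * pQ) <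
    ((Finset.univ.filter fun k => ω ∈ EQ k).card : ℝ)} with hBQ
  set BN := {ω | 9 * (sN.card * pN) < ((sN.filter fun k => ω ∈ EN k).card : ℝ)} with hBN
  set BF := {ω | 9 * (sF.card * pF) < ((sF.filter fun k => ω ∈ EF k).card : ℝ)} with hBF
  set Bz := {ω : (Fin m → Fin d → ℝ) × (Fin m → ℝ) |
    ¬ ∀ i, |ω.2 i| ≤ tlapRadius 1 ε δ} with hBz
  have hcover : (Set.univ : Set ((Fin m → Fin d → ℝ) × (Fin m → ℝ))) ⊆
      good ∪ (BQ ∪ BN ∪ BF ∪ Bz) := by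
    intro ω _
    by_cases hω : ω ∈ BQ ∪ BN ∪ BF ∪ Bz
    · exact Or.inr hω
    refine Or.inl ?_
    simp only [Set.mem_union, not_or] at hω
    obtain ⟨⟨⟨h1, h2⟩, h3⟩, h4⟩ := hω
    have h1 : ((Finset.univ.filter fun k => ω ∈ EQ k).card : ℝ) ≤
      9 * ((Finset.univ : Finset (Fin m)).card * pQ) := not_lt.1 h1
    have h2 : ((sN.filter fun k => ω ∈ EN k).card : ℝ) ≤ 9 * (sN.card * pN) := not_lt.1 h2
    have h3 : ((sF.filter fun k => ω ∈ EF k).card : ℝ) ≤ 9 * (sF.card * pF) := not_lt.1 h3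
    have h4 : ∀ i, |ω.2 i| ≤ tlapRadius 1 ε δ := not_not.1 h4
    have hq := abs_query_build_sub_le (n := n) (α := α) (β := β) (Finset.univ.val.map x) q ω.1 ω.2 h4
    have hu := sum_bucketCount_le (toFilters ω.1) x q η β
    have hl := le_sum_bucketCount (toFilters ω.1) x q η hm α
    have hq := abs_le.1 (hq.trans (mul_le_mul_of_nonneg_right h1 (by positivity)))
    rw [Finset.card_univ, Fintype.card_fin] at hq
    have hu' := (Nat.cast_le (α := ℝ)).2 hu
    have hl' := (Nat.cast_le (α := ℝ)).2 hl
    rw [Nat.cast_add] at hu' hl'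
    have hsF : 9 * ((sF.card : ℝ) * pF) ≤ 9 * (n * pF) := by
      have : (sF.card : ℝ) ≤ n := by
        exact_mod_cast (Finset.card_le_univ sF).trans_eq (Fintype.card_fin n)
      gcongr
    have hsN : (sN.card : ℝ) = ballCount (Finset.univ.val.map x) q α := by
      rw [ballCount_map]
    rw [hsN] at h2
    have hu'' := hu'.trans (add_le_add_right (h3.trans hsF) _)
    have hl'' := hl'.trans (add_le_add_right h2 _)
    constructor
    · linarith [hq.1]
    · linarith [hq.2]
  -- Three Markov bounds of 1/9 each; the noise bound fails only on a null set.
  have h1 : (1 : ℝ≥0∞) ≤ μ good + 1 / 3 := by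
    refine (measure_univ (μ := μ)).symm.le.trans ?_
    refine (measure_mono hcover).trans ((measure_union_le _ _).trans (add_le_add_right ?_ _))
    refine (measure_union_le _ _).trans ?_
    rw [bz, add_zero]
    have bN' : μ BN ≤ 1 / 9 := by convert bN
    have bF' : μ BF ≤ 1 / 9 := by convert bF
    refine ((measure_union_le _ _).trans (add_le_add ((measure_union_le _ _).trans
      (add_le_add bQ bN')) bF')).trans (le_of_eq ?_)
    rw [ENNReal.div_add_div_same, ENNReal.div_add_div_same,
      ENNReal.div_eq_div_iff (by simp) (by simp) (by simp) (by simp)]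
    norm_num
  have h2 : (1 : ℝ≥0∞) = 2 / 3 + 1 / 3 := by
    rw [ENNReal.div_add_div_same, eq_comm]
    norm_num [ENNReal.div_self]
  have h3 : (1 / 3 : ℝ≥0∞) ≠ ⊤ := by finiteness
  exact (ENNReal.add_le_add_iff_right h3).1 (h2.symm.le.trans h1)

/-! ### Levels of the Gaussian maximum -/

/-- The level `√(2 (l - k log l))`. -/
def level (l k : ℝ) : ℝ := √(2 * (l - k * Real.log l))

/-- The relative error `√(log l / ((1 - α²) l))`. -/
def slack (α l : ℝ) : ℝ := √(Real.log l / ((1 - α ^ 2) * l))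

section Levels

variable {α l : ℝ}

lemma one_sub_sq_pos (hα0 : 0 < α) (hα1 : α < 1) : 0 < 1 - α ^ 2 := by nlinarith

lemma log_le_of_le_slack (hα0 : 0 < α) (hα1 : α < 1) (hl : 1024 ≤ l) (hs : slack α l ≤ 1 / 12) :
    144 * Real.log l ≤ (1 - α ^ 2) * l := by
  have hθ : 0 < (1 - α ^ 2) * l := mul_pos (one_sub_sq_pos hα0 hα1) (by linarith)
  have h := (Real.sqrt_le_left (by norm_num)).1 hs
  rw [div_le_iff₀ hθ] at h
  linarith

lemma slack_sq_mul (hα0 : 0 < α) (hα1 : α < 1) (hl : 1024 ≤ l) :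
    (1 - α ^ 2) * l * slack α l ^ 2 = Real.log l := by
  have hθ : 0 < (1 - α ^ 2) * l := mul_pos (one_sub_sq_pos hα0 hα1) (by linarith)
  rw [slack, Real.sq_sqrt (div_nonneg (Real.log_nonneg (by linarith)) hθ.le),
    mul_div_cancel₀ _ hθ.ne']

lemma sqrt_mul_sqrt_eq (hα0 : 0 < α) (hα1 : α < 1) (hl : 1024 ≤ l) :
    √(2 * (1 - α ^ 2) * Real.log l) * √(2 * l) = 2 * ((1 - α ^ 2) * l * slack α l) := by
  have h0 := one_sub_sq_pos hα0 hα1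
  have hlog : 0 ≤ Real.log l := Real.log_nonneg (by linarith)
  have hs : 0 ≤ slack α l := Real.sqrt_nonneg _
  rw [← Real.sqrt_mul (by positivity), ← slack_sq_mul hα0 hα1 hl, Real.sqrt_eq_iff_mul_self_eq]
  · ring
  · exact mul_nonneg (by positivity) (by linarith)
  · exact mul_nonneg zero_le_two (mul_nonneg (mul_nonneg h0.le (by linarith)) hs)

lemma level_sq (hα0 : 0 < α) (hα1 : α < 1) (hl : 1024 ≤ l) (hs : slack α l ≤ 1 / 12) {k : ℝ}
    (hk : k ≤ 2) : level l k ^ 2 / 2 = l - k * Real.log l := by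
  have h := log_le_of_le_slack hα0 hα1 hl hs
  have hlog : 0 ≤ Real.log l := Real.log_nonneg (by linarith)
  rw [level, Real.sq_sqrt (by nlinarith)]
  ring

lemma one_le_level (hα0 : 0 < α) (hα1 : α < 1) (hl : 1024 ≤ l) (hs : slack α l ≤ 1 / 12) {k : ℝ}
    (hk : k ≤ 2) : 1 ≤ level l k := by
  have h := log_le_of_le_slack hα0 hα1 hl hs
  have hlog : 0 ≤ Real.log l := Real.log_nonneg (by linarith)
  rw [level, Real.one_le_sqrt]
  nlinarith

lemma level_le_sqrt (hl : 1024 ≤ l) {k : ℝ} (hk : 0 ≤ k) : level l k ≤ √(2 * l) := by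
  have hlog : 0 ≤ Real.log l := Real.log_nonneg (by linarith)
  exact Real.sqrt_le_sqrt (by nlinarith)

/-- The level is close to L = √(2l): (L - M)·L ≤ L² - M² = 2k log l. With v = √(2(1-α²) log l), the
identities vL = 2(1-α²)l·s and (1-α²)l·s² = log l for s = `slack α l` turn this into L - M ≤ k·v·s.
-/
lemma le_level_sub_threshold (hα0 : 0 < α) (hα1 : α < 1) (hl : 1024 ≤ l)
    (hs : slack α l ≤ 1 / 12) {k : ℝ} (hk0 : 0 ≤ k) (hk : k ≤ 2) :
    √(2 * (1 - α ^ 2) * Real.log l) * (1 - k * slack α l) ≤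
      α * level l k - (α * √(2 * l) - √(2 * (1 - α ^ 2) * Real.log l)) := by
  have hL : 0 < √(2 * l) := Real.sqrt_pos.2 (by linarith)
  have hM := one_le_level hα0 hα1 hl hs hk
  have hML := level_le_sqrt hl hk0
  have hM2 := level_sq hα0 hα1 hl hs hk
  have hL2 : √(2 * l) ^ 2 = 2 * l := Real.sq_sqrt (by linarith)
  have h1 : (√(2 * l) - level l k) * √(2 * l) ≤ 2 * k * Real.log l := by
    nlinarith
  have h2 : √(2 * l) - level l k ≤ k * (√(2 * (1 - α ^ 2) * Real.log l) * slack α l) := by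
    refine le_of_mul_le_mul_right (h1.trans (le_of_eq ?_)) hL
    have h3 := sqrt_mul_sqrt_eq hα0 hα1 hl
    have h4 := slack_sq_mul hα0 hα1 hl
    linear_combination (-2 * k) * h4 - k * slack α l * h3
  nlinarith

/-- With e^l = m this bounds from below the expected number of filters above the level: m·e^(-M²/2)
= l^k, and dividing by M ≤ 2√l costs a factor of order l^(1/2). -/
lemma le_exp_mul_exp_level (hα0 : 0 < α) (hα1 : α < 1) (hl : 1024 ≤ l)
    (hs : slack α l ≤ 1 / 12) {k : ℝ} (hk0 : 0 ≤ k) (hk : k ≤ 2) :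
    Real.exp ((k - 1 / 2) * Real.log l) / 32 ≤
      Real.exp l * (1 / 16 * (Real.exp (-(level l k ^ 2 / 2)) / level l k)) := by
  have hM := one_le_level hα0 hα1 hl hs hk
  have hl0 : 0 < l := by linarith
  have h1 : level l k ≤ 2 * Real.exp (1 / 2 * Real.log l) := by
    have h2 : Real.exp (1 / 2 * Real.log l) = √l := by
      rw [Real.sqrt_eq_rpow, Real.rpow_def_of_pos hl0, mul_comm]
    rw [h2]
    refine (level_le_sqrt hl hk0).trans ?_
    rw [Real.sqrt_mul zero_le_two]
    have : √2 ≤ 2 := by rw [Real.sqrt_le_left (by norm_num)]; norm_num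
    gcongr
  rw [level_sq hα0 hα1 hl hs hk, neg_sub, div_le_iff₀ (by norm_num)]
  have h3 : Real.exp l * Real.exp (k * Real.log l - l) = Real.exp (k * Real.log l) := by
    rw [← Real.exp_add]; ring_nf
  have h4 : Real.exp ((k - 1 / 2) * Real.log l) * Real.exp (1 / 2 * Real.log l) =
      Real.exp (k * Real.log l) := by
    rw [← Real.exp_add]; ring_nf
  have h5 : Real.exp l * (1 / 16 * (Real.exp (k * Real.log l - l) / level l k)) * 32 =
      2 * Real.exp (k * Real.log l) / level l k := by
    rw [← h3]; ring
  rw [h5, le_div_iff₀ (by linarith), ← h4]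
  have := Real.exp_pos ((k - 1 / 2) * Real.log l)
  nlinarith

/-- This is the side condition r·t ≤ M of the Chernoff bound, needed with β for far points and with
α for near ones. The threshold may be negative. -/
lemma mul_threshold_le_level (hα0 : 0 < α) (hα1 : α < 1) (hl : 1024 ≤ l)
    (hs : slack α l ≤ 1 / 12) {k β : ℝ} (hk0 : 0 ≤ k) (hk : k ≤ 2) (hβ0 : 0 ≤ β) (hβ1 : β ≤ 1) :
    β * (α * √(2 * l) - √(2 * (1 - α ^ 2) * Real.log l)) ≤ level l k := by
  have h := le_level_sub_threshold hα0 hα1 hl hs hk0 hk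
  have hM := one_le_level hα0 hα1 hl hs hk
  have hs0 : 0 ≤ slack α l := Real.sqrt_nonneg _
  have h1 : 0 ≤ √(2 * (1 - α ^ 2) * Real.log l) * (1 - k * slack α l) :=
    mul_nonneg (Real.sqrt_nonneg _) (by nlinarith)
  have h2 : α * √(2 * l) - √(2 * (1 - α ^ 2) * Real.log l) ≤ level l k := by nlinarith
  rcases le_total (α * √(2 * l) - √(2 * (1 - α ^ 2) * Real.log l)) 0 with h3 | h3 <;> nlinarith

lemma sq_sub_le_max_sq {u v : ℝ} (hu : 0 ≤ u) : u ^ 2 - 2 * u * v ≤ max 0 (u - v) ^ 2 := by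
  rcases le_total (u - v) 0 with h | h
  · rw [max_eq_left h]; nlinarith
  · rw [max_eq_right h]; nlinarith [sq_nonneg v]

/-- The Chernoff bound with t = -η and r = -α. The level contributes l^(3/4), and the deviation αM -
η, nearly √(2(1-α²) log l), contributes at most l^(-7/8); together l^(-1/8). -/
lemma near_exponent_le (hα0 : 0 < α) (hα1 : α < 1) (hl : 1024 ≤ l) (hs : slack α l ≤ 1 / 12) :
    Real.exp l * Real.exp (-(level l (3 / 4) ^ 2 / 2) -
      max 0 (-(α * √(2 * l) - √(2 * (1 - α ^ 2) * Real.log l)) - -α * level l (3 / 4)) ^ 2 /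
        (2 * (1 - (-α) ^ 2))) ≤ Real.exp (-(Real.log l / 8)) := by
  have h := le_level_sub_threshold hα0 hα1 hl hs (k := 3 / 4) (by norm_num) (by norm_num)
  have hα := one_sub_sq_pos hα0 hα1
  have hlog : 0 ≤ Real.log l := Real.log_nonneg (by linarith)
  have hs0 : 0 ≤ slack α l := Real.sqrt_nonneg _
  have hv : 0 ≤ √(2 * (1 - α ^ 2) * Real.log l) * (1 - 3 / 4 * slack α l) :=
    mul_nonneg (Real.sqrt_nonneg _) (by linarith)
  have h1 : 2 * (1 - α ^ 2) * (7 / 8 * Real.log l) ≤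
      max 0 (-(α * √(2 * l) - √(2 * (1 - α ^ 2) * Real.log l)) - -α * level l (3 / 4)) ^ 2 := by
    have h2 := pow_le_pow_left₀ hv (h.trans (le_max_right 0 _)) 2
    rw [mul_pow, Real.sq_sqrt (by positivity)] at h2
    -- Here 1/12 enters: (1 - 3s/4)² ≥ 1 - 3s/2 ≥ 7/8.
    have h3 : 7 / 8 ≤ (1 - 3 / 4 * slack α l) ^ 2 := by nlinarith
    have h4 : 2 * (1 - α ^ 2) * (7 / 8 * Real.log l) ≤
        2 * (1 - α ^ 2) * Real.log l * (1 - 3 / 4 * slack α l) ^ 2 := by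
      have : 0 ≤ 2 * (1 - α ^ 2) * Real.log l := by positivity
      nlinarith
    refine h4.trans (h2.trans (le_of_eq ?_))
    congr 2
    ring
  rw [level_sq hα0 hα1 hl hs (by norm_num), ← Real.exp_add, Real.exp_le_exp, neg_sq]
  have h5 := (le_div_iff₀ (by positivity : 0 < 2 * (1 - α ^ 2))).2
    ((mul_comm _ _).trans_le h1)
  linarith

/-- The deviation is at least (α-β)L - v; its square gives the main term (α-β)²l/(1-β²) with a loss
of at most vL = 2(1-α²)l·s. The level k = 2 costs l², and log l ≤ (1-α²)l·s, whence the factor 4. -/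
lemma far_exponent_le (hα0 : 0 < α) (hα1 : α < 1) (hl : 1024 ≤ l) (hs : slack α l ≤ 1 / 12)
    {β : ℝ} (hβ0 : 0 ≤ β) (hβ : β < α) :
    Real.exp l * Real.exp (-(level l 2 ^ 2 / 2) -
      max 0 (α * √(2 * l) - √(2 * (1 - α ^ 2) * Real.log l) - β * level l 2) ^ 2 /
        (2 * (1 - β ^ 2))) ≤
      Real.exp (4 * ((1 - α ^ 2) * l * slack α l) - (α - β) ^ 2 * l / (1 - β ^ 2)) := by
  have hs0 : 0 ≤ slack α l := Real.sqrt_nonneg _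
  have hβ2 : 0 < 1 - β ^ 2 := by nlinarith
  have hα := one_sub_sq_pos hα0 hα1
  set v := √(2 * (1 - α ^ 2) * Real.log l) with hv
  have hv0 : 0 ≤ v := Real.sqrt_nonneg _
  set L := √(2 * l) with hL
  have hL0 : 0 ≤ L := Real.sqrt_nonneg _
  have hL2 : L ^ 2 = 2 * l := Real.sq_sqrt (by linarith)
  have hML : level l 2 ≤ L := level_le_sqrt hl zero_le_two
  have hvL : v * L = 2 * ((1 - α ^ 2) * l * slack α l) := sqrt_mul_sqrt_eq hα0 hα1 hl
  have hu : 0 ≤ (α - β) * L := mul_nonneg (by linarith) hL0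
  have h1 : ((α - β) * L) ^ 2 - 2 * ((α - β) * L) * v ≤
      max 0 (α * L - v - β * level l 2) ^ 2 := by
    refine (sq_sub_le_max_sq hu).trans (pow_le_pow_left₀ (le_max_left _ _) ?_ 2)
    refine max_le_max le_rfl ?_
    nlinarith
  have h2 : (α - β) ^ 2 * l / (1 - β ^ 2) - v * L ≤
      max 0 (α * L - v - β * level l 2) ^ 2 / (2 * (1 - β ^ 2)) := by
    rw [sub_le_iff_le_add, div_add' _ _ _ (by positivity), div_le_div_iff₀ hβ2 (by positivity)]
    -- Since α - β ≤ 1 - β ≤ 1 - β², the cross term stays bounded after division by 1 - β².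
    have h3 : (α - β) * (v * L) ≤ (1 - β ^ 2) * (v * L) :=
      mul_le_mul_of_nonneg_right (by nlinarith) (mul_nonneg hv0 hL0)
    have h4 : 2 * ((α - β) ^ 2 * l) ≤
        max 0 (α * L - v - β * level l 2) ^ 2 + v * L * (2 * (1 - β ^ 2)) := by
      nlinarith
    nlinarith
  rw [level_sq hα0 hα1 hl hs le_rfl, ← Real.exp_add, Real.exp_le_exp]
  have h5 : Real.log l ≤ (1 - α ^ 2) * l * slack α l := by
    rw [← slack_sq_mul hα0 hα1 hl]
    have : 0 ≤ (1 - α ^ 2) * l * slack α l :=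
      mul_nonneg (mul_nonneg hα.le (by linarith)) hs0
    nlinarith
  linarith

lemma query_exponent_le (hα0 : 0 < α) (hα1 : α < 1) (hl : 1024 ≤ l) :
    Real.exp l * Real.exp (-(max 0 (α * √(2 * l) - √(2 * (1 - α ^ 2) * Real.log l)) ^ 2 / 2)) ≤
      Real.exp ((1 - α ^ 2) * l + 2 * ((1 - α ^ 2) * l * slack α l)) := by
  have hs0 : 0 ≤ slack α l := Real.sqrt_nonneg _
  have hα := one_sub_sq_pos hα0 hα1
  have hvL := sqrt_mul_sqrt_eq hα0 hα1 hl
  have hL2 : √(2 * l) ^ 2 = 2 * l := Real.sq_sqrt (by linarith)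
  have h1 := sq_sub_le_max_sq (u := α * √(2 * l)) (v := √(2 * (1 - α ^ 2) * Real.log l))
    (mul_nonneg hα0.le (Real.sqrt_nonneg _))
  rw [mul_pow, hL2] at h1
  rw [← Real.exp_add, Real.exp_le_exp]
  have h2 : α * ((1 - α ^ 2) * l * slack α l) ≤ 1 * ((1 - α ^ 2) * l * slack α l) :=
    mul_le_mul_of_nonneg_right hα1.le (mul_nonneg (mul_nonneg hα.le (by linarith)) hs0)
  nlinarith

end Levels

/-! ### The number of filters -/

section NumFilters

variable {n : ℕ} {α β : ℝ}

lemma one_sub_mul_pos (hβ0 : 0 ≤ β) (hβ : β < α) (hα : α < 1) : 0 < 1 - α * β := by nlinarith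

lemma one_le_exponent (hβ0 : 0 ≤ β) (hβ : β < α) (hα : α < 1) :
    1 ≤ (1 - β ^ 2) / (1 - α * β) ^ 2 := by
  have h := one_sub_mul_pos hβ0 hβ hα
  rw [one_le_div (by positivity)]
  have h1 : 0 ≤ β * (2 * (α - β) + β * (1 - α ^ 2)) := by
    have : 0 ≤ 1 - α ^ 2 := by nlinarith
    have : 0 ≤ α - β := by linarith
    positivity
  nlinarith

lemma rho_eq : rho α β = (1 - α ^ 2) * ((1 - β ^ 2) / (1 - α * β) ^ 2) := by
  rw [rho, mul_div_assoc]

lemma rho_div (hβ0 : 0 ≤ β) (hβ : β < α) (hα : α < 1) :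
    rho α β / (1 - α ^ 2) = (1 - β ^ 2) / (1 - α * β) ^ 2 := by
  rw [rho_eq, mul_div_cancel_left₀]
  nlinarith

/-- This rests on (1-αβ)² - (1-α²)(1-β²) = (α-β)². With `rho_eq` it says that found far points and
queried filters lead to the same exponent. -/
lemma one_sub_rho (hβ0 : 0 ≤ β) (hβ : β < α) (hα : α < 1) :
    1 - rho α β = (α - β) ^ 2 / (1 - β ^ 2) * ((1 - β ^ 2) / (1 - α * β) ^ 2) := by
  have h := (one_sub_mul_pos hβ0 hβ hα).ne'
  have h2 : 1 - β ^ 2 ≠ 0 := by nlinarith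
  rw [rho]
  field_simp
  ring

lemma rho_pos (hβ0 : 0 ≤ β) (hβ : β < α) (hα : α < 1) : 0 < rho α β := by
  have h := one_sub_mul_pos hβ0 hβ hα
  have h1 : 0 < 1 - α ^ 2 := by nlinarith
  have h2 : 0 < 1 - β ^ 2 := by nlinarith
  unfold rho
  positivity

lemma rho_le_one (hβ0 : 0 ≤ β) (hβ : β < α) (hα : α < 1) : rho α β ≤ 1 := by
  have h := one_sub_rho hβ0 hβ hα
  have h0 := one_sub_mul_pos hβ0 hβ hα
  have h2 : 0 < 1 - β ^ 2 := by nlinarith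
  have : 0 ≤ (α - β) ^ 2 / (1 - β ^ 2) * ((1 - β ^ 2) / (1 - α * β) ^ 2) := by positivity
  linarith

lemma le_numFilters : (n : ℝ) ^ ((1 - β ^ 2) / (1 - α * β) ^ 2) ≤ numFilters n α β :=
  Nat.le_ceil _

lemma one_le_rpow_exponent (hn : 1 ≤ n) (hβ0 : 0 ≤ β) (hβ : β < α) (hα : α < 1) :
    1 ≤ (n : ℝ) ^ ((1 - β ^ 2) / (1 - α * β) ^ 2) :=
  Real.one_le_rpow (by exact_mod_cast hn) (zero_le_one.trans (one_le_exponent hβ0 hβ hα))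

lemma numFilters_le (hn : 1 ≤ n) (hβ0 : 0 ≤ β) (hβ : β < α) (hα : α < 1) :
    (numFilters n α β : ℝ) ≤ 2 * (n : ℝ) ^ ((1 - β ^ 2) / (1 - α * β) ^ 2) := by
  have h1 := one_le_rpow_exponent hn hβ0 hβ hα
  have h2 := (Nat.ceil_lt_add_one (zero_le_one.trans h1)).le
  unfold numFilters
  linarith

lemma self_le_numFilters (hn : 1 ≤ n) (hβ0 : 0 ≤ β) (hβ : β < α) (hα : α < 1) :
    (n : ℝ) ≤ numFilters n α β := by
  refine le_trans ?_ (le_numFilters (n := n) (α := α) (β := β))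
  exact Real.self_le_rpow_of_one_le (by exact_mod_cast hn) (one_le_exponent hβ0 hβ hα)

lemma numFilters_pos (hn : 1 ≤ n) (hβ0 : 0 ≤ β) (hβ : β < α) (hα : α < 1) :
    0 < numFilters n α β := by
  have h := self_le_numFilters hn hβ0 hβ hα
  have : (1 : ℝ) ≤ n := by exact_mod_cast hn
  exact_mod_cast (by linarith : (0 : ℝ) < numFilters n α β)

lemma le_log_numFilters (hn : 1 ≤ n) :
    (1 - β ^ 2) / (1 - α * β) ^ 2 * Real.log n ≤ Real.log (numFilters n α β) := by
  have hn0 : (0 : ℝ) < n := by exact_mod_cast hn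
  rw [← Real.log_rpow hn0]
  exact Real.log_le_log (Real.rpow_pos_of_pos hn0 _) le_numFilters

lemma log_numFilters_le (hn : 1 ≤ n) (hβ0 : 0 ≤ β) (hβ : β < α) (hα : α < 1) :
    Real.log (numFilters n α β) ≤ (1 - β ^ 2) / (1 - α * β) ^ 2 * Real.log n + Real.log 2 := by
  have hn0 : (0 : ℝ) < n := by exact_mod_cast hn
  rw [← Real.log_rpow hn0, add_comm, ← Real.log_mul two_ne_zero (Real.rpow_pos_of_pos hn0 _).ne']
  exact Real.log_le_log (by exact_mod_cast numFilters_pos hn hβ0 hβ hα)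
    (numFilters_le hn hβ0 hβ hα)

end NumFilters

/-! ### Accuracy -/

/-- A bound for the probability that a near point is missed, in terms of `l = log m`. -/
def missProb (l : ℝ) : ℝ :=
  Real.exp (-(Real.exp (1 / 4 * Real.log l) / 32)) + Real.exp (-(Real.log l / 8))

lemma tendsto_missProb : Tendsto missProb atTop (𝓝 0) := by
  have h1 : Tendsto (fun l : ℝ => Real.exp (1 / 4 * Real.log l) / 32) atTop atTop :=
    (Real.tendsto_exp_atTop.comp
      (Real.tendsto_log_atTop.const_mul_atTop (by norm_num))).atTop_div_const (by norm_num)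
  have h2 : Tendsto (fun l : ℝ => Real.log l / 8) atTop atTop :=
    Real.tendsto_log_atTop.atTop_div_const (by norm_num)
  have h := (Real.tendsto_exp_neg_atTop_nhds_zero.comp h1).add
    (Real.tendsto_exp_neg_atTop_nhds_zero.comp h2)
  rw [add_zero] at h
  exact h

/-- The logarithm in the radius is at most ε + log(1/δ), and since log(1/δ) ≥ log 2, the bounded
term ε is absorbed into a multiple of log(1/δ). -/
lemma tlapRadius_le {ε ε₀ δ : ℝ} (hε : 0 < ε) (hε₀ : ε ≤ ε₀) (hδ : 0 < δ) (hδ' : δ < 1 / 2) :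
    tlapRadius 1 ε δ ≤ (ε₀ / Real.log 2 + 1) * (Real.log (1 / δ) / ε) := by
  have hlog2 : 0 < Real.log 2 := Real.log_pos one_lt_two
  have h1 : 1 + (Real.exp ε - 1) / (2 * δ) ≤ Real.exp ε * (1 / δ) := by
    have he := Real.one_le_exp hε.le
    rw [mul_one_div, ← sub_nonneg]
    have : Real.exp ε / δ - (1 + (Real.exp ε - 1) / (2 * δ)) =
        (Real.exp ε + 1 - 2 * δ) / (2 * δ) := by field_simp; ring
    rw [this]
    exact div_nonneg (by linarith) (by positivity)
  have h0 : 0 ≤ (Real.exp ε - 1) / (2 * δ) :=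
    div_nonneg (by linarith [Real.add_one_le_exp ε]) (by positivity)
  have h2 := Real.log_le_log (by linarith) h1
  rw [Real.log_mul (Real.exp_pos _).ne' (by positivity), Real.log_exp] at h2
  have h3 : Real.log 2 ≤ Real.log (1 / δ) := by
    refine Real.log_le_log two_pos ?_
    rw [le_div_iff₀ hδ]; linarith
  have h4 : ε ≤ ε₀ / Real.log 2 * Real.log (1 / δ) := by
    have : ε₀ = ε₀ / Real.log 2 * Real.log 2 := by field_simp
    have h5 : 0 ≤ ε₀ / Real.log 2 := div_nonneg (by linarith) hlog2.le
    nlinarith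
  rw [tlapRadius, one_div_mul_eq_div, ← mul_div_assoc]
  refine div_le_div_of_nonneg_right ?_ hε.le
  linarith

set_option maxHeartbeats 600000 in
-- Near points use the level k = 3/4, where l^(k-1/2) still tends to infinity while k < 7/8; far
-- points use k = 2, where the maximum falls short with probability at most e^(-l) = 1/m ≤ 1/n. The
-- 8 in the exponent is the 4 of `far_exponent_le` times the 2 of (1-α²)l ≤ 2 log n.
lemma construction_accuracy_of_le {d n : ℕ} {α β ε ε₀ δ : ℝ} (hn : 2 ≤ n) (hβ0 : 0 ≤ β)
    (hβ : β < α) (hα : α < 1) (hl : 1024 ≤ Real.log (numFilters n α β))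
    (hs : slack α (Real.log (numFilters n α β)) ≤ 1 / 12)
    (hε : 0 < ε) (hε₀ : ε ≤ ε₀) (hδ : 0 < δ) (hδ' : δ < 1 / 2) (S : Multiset (Sph d)) (q : Sph d)
    (hS : S.card = n) :
    2 / 3 ≤ construction n α β ε δ S
      {D | (1 - 9 * missProb (Real.log (numFilters n α β))) * (ballCount S q α : ℝ) -
          54 * (ε₀ / Real.log 2 + 1) * (Real.log (1 / δ) / ε *
            (n : ℝ) ^ (rho α β + 8 * slack α (Real.log (numFilters n α β)))) ≤ D.query q ∧
        D.query q ≤ (ballCount S q β : ℝ) +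
          54 * (ε₀ / Real.log 2 + 1) * (Real.log (1 / δ) / ε *
            (n : ℝ) ^ (rho α β + 8 * slack α (Real.log (numFilters n α β))))} := by
  obtain ⟨x, rfl⟩ := exists_eq_map_univ S hS
  have hα0 : 0 < α := hβ0.trans_lt hβ
  have hn1 : 1 ≤ n := by omega
  have hm := numFilters_pos hn1 hβ0 hβ hα
  have hnR : (0 : ℝ) < n := by positivity
  have hmR : (0 : ℝ) < numFilters n α β := by exact_mod_cast hm
  have hnm := self_le_numFilters hn1 hβ0 hβ hα
  have hlow := le_log_numFilters (α := α) (β := β) hn1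
  have hupp := log_numFilters_le hn1 hβ0 hβ hα
  set m := numFilters n α β with hmdef
  have hη : threshold m α =
    α * √(2 * Real.log m) - √(2 * (1 - α ^ 2) * Real.log (Real.log m)) := rfl
  set l := Real.log m with hldef
  have hml : (m : ℝ) = Real.exp l := (Real.exp_log hmR).symm
  have hs0 : 0 ≤ slack α l := Real.sqrt_nonneg _
  have hαs := one_sub_sq_pos hα0 hα
  have hβs : 0 < 1 - β ^ 2 := by nlinarith
  have hlog2n : Real.log 2 ≤ Real.log n := Real.log_le_log two_pos (by exact_mod_cast hn)
  have hlogn : 0 ≤ Real.log n := Real.log_nonneg (by exact_mod_cast hn1)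
  have hθ1 : (1 - α ^ 2) * l ≤ rho α β * Real.log n + Real.log 2 := by
    have h1 := mul_le_mul_of_nonneg_left hupp hαs.le
    rw [mul_add, ← mul_assoc, ← rho_eq] at h1
    have : (1 - α ^ 2) * Real.log 2 ≤ 1 * Real.log 2 :=
      mul_le_mul_of_nonneg_right (by nlinarith) (Real.log_nonneg one_le_two)
    linarith
  have hθ2 : (1 - α ^ 2) * l ≤ 2 * Real.log n := by
    have : rho α β * Real.log n ≤ 1 * Real.log n :=
      mul_le_mul_of_nonneg_right (rho_le_one hβ0 hβ hα) hlogn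
    linarith
  have hθs : (1 - α ^ 2) * l * slack α l ≤ 2 * Real.log n * slack α l :=
    mul_le_mul_of_nonneg_right hθ2 hs0
  have hu : (1 - rho α β) * Real.log n ≤ (α - β) ^ 2 * l / (1 - β ^ 2) := by
    rw [one_sub_rho hβ0 hβ hα, mul_assoc, mul_div_right_comm]
    exact mul_le_mul_of_nonneg_left hlow (by positivity)
  set R : ℝ := (n : ℝ) ^ (rho α β + 8 * slack α l) with hR
  have hRexp : R = Real.exp ((rho α β + 8 * slack α l) * Real.log n) := by
    rw [hR, Real.rpow_def_of_pos hnR, mul_comm]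
  have hR1 : 1 ≤ R := by
    rw [hRexp]
    have := rho_pos hβ0 hβ hα
    exact Real.one_le_exp (by positivity)
  have hx : ∀ k, ‖(x k : Vec d)‖ = 1 := fun k => by simp
  have hq : ‖(q : Vec d)‖ = 1 := by simp
  have hα2 : α ^ 2 < 1 := by linarith
  have hβ2 : β ^ 2 < 1 := by linarith
  have hacc := construction_accuracy hε hδ hδ' hm x q
    (pQ := Real.exp (-(max 0 (threshold m α) ^ 2 / 2)))
    (pN := missProb l)
    (pF := Real.exp (-l) +
      Real.exp (4 * ((1 - α ^ 2) * l * slack α l) - (α - β) ^ 2 * l / (1 - β ^ 2)))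
    (Real.exp_pos _).le (by unfold missProb; positivity) (by positivity)
    (fun i => gaussFilters_inner_ge_le hq _ i)
    (fun k hk => by
      have hin : ⟪(x k : Vec d), -(q : Vec d)⟫ ≤ -α := by
        rw [inner_neg_right, real_inner_comm]; linarith
      refine (gaussFilters_argmax_le (hx k) (by rw [norm_neg, hq]) hin (by rwa [neg_sq])
        (one_le_level hα0 hα hl hs (k := 3 / 4) (by norm_num)) ?_).trans (add_le_add ?_ ?_)
      · rw [neg_mul_neg, hη]
        exact mul_threshold_le_level hα0 hα hl hs (by norm_num) (by norm_num) hα0.le hα.le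
      · rw [hml]
        refine Real.exp_le_exp.2 (neg_le_neg ?_)
        refine le_of_eq_of_le ?_
          (le_exp_mul_exp_level hα0 hα hl hs (k := 3 / 4) (by norm_num) (by norm_num))
        norm_num
      · rw [hml, hη]
        exact near_exponent_le hα0 hα hl hs)
    (fun k hk => by
      have hin : ⟪(x k : Vec d), (q : Vec d)⟫ ≤ β := by
        rw [real_inner_comm]; linarith
      refine (gaussFilters_argmax_le (hx k) hq hin hβ2
        (one_le_level hα0 hα hl hs (k := 2) le_rfl) ?_).trans (add_le_add ?_ ?_)
      · rw [hη]
        exact mul_threshold_le_level hα0 hα hl hs zero_le_two le_rfl hβ0 (hβ.trans hα).le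
      · rw [hml]
        refine Real.exp_le_exp.2 (neg_le_neg (le_trans ?_
          (le_exp_mul_exp_level hα0 hα hl hs zero_le_two le_rfl)))
        have hl0 : 0 < l := by linarith
        have h1 : Real.exp ((2 - 1 / 2) * Real.log l) = l * √l := by
          rw [Real.sqrt_eq_rpow, Real.rpow_def_of_pos hl0]
          nth_rewrite 2 [← Real.exp_log hl0]
          rw [← Real.exp_add]; ring_nf
        -- Here l ≥ 1024 enters: l^(3/2)/32 ≥ l.
        have h2 : 32 ≤ √l := Real.le_sqrt_of_sq_le (by norm_num; linarith)
        rw [h1, le_div_iff₀ (by norm_num)]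
        exact mul_le_mul_of_nonneg_left h2 hl0.le
      · rw [hml, hη]
        exact far_exponent_le hα0 hα hl hs hβ0 hβ)
  have hNQ : (m : ℝ) * Real.exp (-(max 0 (threshold m α) ^ 2 / 2)) ≤ 2 * R := by
    rw [hml, hη]
    refine (query_exponent_le hα0 hα hl).trans ?_
    rw [hRexp]
    nth_rewrite 2 [← Real.exp_log two_pos]
    rw [← Real.exp_add, Real.exp_le_exp]
    nlinarith
  have hNF : n * (Real.exp (-l) +
      Real.exp (4 * ((1 - α ^ 2) * l * slack α l) - (α - β) ^ 2 * l / (1 - β ^ 2))) ≤ 2 * R := by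
    have h1 : (n : ℝ) * Real.exp (-l) ≤ 1 := by
      rw [Real.exp_neg, ← hml, ← div_eq_mul_inv, div_le_one hmR]; exact hnm
    have h2 : (n : ℝ) * Real.exp (4 * ((1 - α ^ 2) * l * slack α l) -
        (α - β) ^ 2 * l / (1 - β ^ 2)) ≤ R := by
      nth_rewrite 1 [← Real.exp_log hnR]
      rw [hRexp, ← Real.exp_add, Real.exp_le_exp]
      nlinarith
    rw [mul_add]
    linarith
  have hA1 := one_le_tlapRadius hε hδ hδ'
  have hA2 := tlapRadius_le hε hε₀ hδ hδ'
  -- With A the radius and R the power of n: 36AR = 9·2R·2A from the noise, and 9·2R ≤ 18AR from far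
  -- points, as A ≥ 1. This makes 54AR.
  have h1 : 9 * (m * Real.exp (-(max 0 (threshold m α) ^ 2 / 2))) * (2 * tlapRadius 1 ε δ) ≤
      36 * (tlapRadius 1 ε δ * R) := by nlinarith
  have h2 : tlapRadius 1 ε δ * R ≤ (ε₀ / Real.log 2 + 1) * (Real.log (1 / δ) / ε) * R :=
    mul_le_mul_of_nonneg_right hA2 (by linarith)
  have h3 : R ≤ tlapRadius 1 ε δ * R := le_mul_of_one_le_left (by linarith) hA1
  refine hacc.trans (measure_mono fun D hD => ?_)
  rw [Set.mem_ofPred_eq] at hD ⊢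
  exact ⟨by linarith [hD.1], by linarith [hD.2]⟩

theorem construction_accuracy_eventually {α β : ℕ → ℝ} (hβ0 : ∀ n, 0 ≤ β n)
    (hβ : ∀ n, β n < α n) (hα : ∀ n, α n < 1)
    (h : (fun n : ℕ => Real.log (Real.log (numFilters n (α n) (β n))) /
          Real.log (numFilters n (α n) (β n))) =o[atTop] (fun n => 1 - α n ^ 2)) :
    ∃ e₁ e₂ : ℕ → ℝ, Tendsto e₁ atTop (𝓝 0) ∧ Tendsto e₂ atTop (𝓝 0) ∧
      ∀ ε₀ : ℝ, 0 < ε₀ → ∃ C : ℝ, 0 < C ∧ ∀ᶠ n : ℕ in atTop,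
        ∀ (d : ℕ) (ε δ : ℝ), 0 < ε → ε ≤ ε₀ → 0 < δ → δ < 1 / 2 →
        ∀ (S : Multiset (Sph d)) (q : Sph d), S.card = n →
          2 / 3 ≤ construction n (α n) (β n) ε δ S
            {D | (1 - e₁ n) * (ballCount S q (α n) : ℝ)
                    - C * (Real.log (1 / δ) / ε * (n : ℝ) ^ (rho (α n) (β n) + e₂ n))
                  ≤ D.query q ∧
                D.query q ≤ (ballCount S q (β n) : ℝ)
                    + C * (Real.log (1 / δ) / ε * (n : ℝ) ^ (rho (α n) (β n) + e₂ n))} := by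
  set l : ℕ → ℝ := fun n => Real.log (numFilters n (α n) (β n)) with hl
  have hlt : Tendsto l atTop atTop := by
    refine tendsto_atTop_mono' atTop ?_ (Real.tendsto_log_atTop.comp tendsto_natCast_atTop_atTop)
    filter_upwards [eventually_ge_atTop 1] with n hn
    exact Real.log_le_log (by exact_mod_cast hn)
      (self_le_numFilters hn (hβ0 n) (hβ n) (hα n))
  -- The slack is the square root of the quotient in the little-o hypothesis.
  have hst : Tendsto (fun n => slack (α n) (l n)) atTop (𝓝 0) := by
    have h1 := (Real.continuous_sqrt.tendsto 0).comp h.tendsto_div_nhds_zero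
    rw [Real.sqrt_zero] at h1
    refine h1.congr fun n => ?_
    simp only [Function.comp_apply, slack, hl]
    rw [div_div, mul_comm]
  refine ⟨fun n => 9 * missProb (l n), fun n => 8 * slack (α n) (l n), ?_, ?_, fun ε₀ hε₀ =>
    ⟨54 * (ε₀ / Real.log 2 + 1), ?_, ?_⟩⟩
  · simpa using (tendsto_missProb.comp hlt).const_mul 9
  · simpa using hst.const_mul 8
  · have := Real.log_pos one_lt_two
    positivity
  · filter_upwards [eventually_ge_atTop 2, hlt.eventually_ge_atTop 1024,
      hst.eventually_le_const (by norm_num : (0 : ℝ) < 1 / 12)] with n hn hln hsn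
    intro d ε δ hε hε' hδ hδ' S q hS
    exact construction_accuracy_of_le hn (hβ0 n) (hβ n) (hα n) hln hsn hε hε' hδ hδ' S q hS

/-! ### Reasoning about RAM programs -/

namespace RAM

/-- The program `p` started in `s` halts after at most `T` steps in a state satisfying `Q`. -/
def Ends (E : Env) (K : ℕ) (p : Prog) (s : State) (T : ℕ) (Q : State → Prop) : Prop :=
  ∃ t s', Run E K p s t s' ∧ t ≤ T ∧ Q s'

section Rules

variable {E : Env} {K : ℕ} {s : State} {Q : State → Prop}

lemma Ends.mono {p : Prog} {T T' : ℕ} {Q' : State → Prop} (h : Ends E K p s T Q) (hT : T ≤ T')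
    (hQ : ∀ s', Q s' → Q' s') : Ends E K p s T' Q' := by
  obtain ⟨t, s', hr, ht, hq⟩ := h
  exact ⟨t, s', hr, ht.trans hT, hQ s' hq⟩

lemma Ends.seq {p q : Prog} {T T' : ℕ} {R : State → Prop} (h : Ends E K p s T R)
    (h' : ∀ s', R s' → Ends E K q s' T' Q) : Ends E K (.seq p q) s (T + T') Q := by
  obtain ⟨t, s', hr, ht, hR⟩ := h
  obtain ⟨t', s'', hr', ht', hQ⟩ := h' s' hR
  exact ⟨t + t', s'', .seq hr hr', add_le_add ht ht', hQ⟩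

lemma Ends.ite {b : Test} {p q : Prog} {T : ℕ} (hp : b.Holds s → Ends E K p s T Q)
    (hq : ¬ b.Holds s → Ends E K q s T Q) : Ends E K (.ite b p q) s (T + 1) Q := by
  by_cases hb : b.Holds s
  · obtain ⟨t, s', hr, ht, hQ⟩ := hp hb
    exact ⟨t + 1, s', .iteTrue hb hr, Nat.succ_le_succ ht, hQ⟩
  · obtain ⟨t, s', hr, ht, hQ⟩ := hq hb
    exact ⟨t + 1, s', .iteFalse hb hr, Nat.succ_le_succ ht, hQ⟩

/-- A loop that runs `N` times, with invariant `I k` after `k` rounds. -/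
lemma Ends.loop {b : Test} {p : Prog} {N T : ℕ} {I : ℕ → State → Prop} (h0 : I 0 s)
    (hstep : ∀ k < N, ∀ s, I k s → b.Holds s ∧ Ends E K p s T (I (k + 1)))
    (hend : ∀ s, I N s → ¬ b.Holds s) : Ends E K (.loop b p) s (N * (T + 1) + 1) (I N) := by
  have key : ∀ r k, k + r = N → ∀ s, I k s →
      Ends E K (.loop b p) s (r * (T + 1) + 1) (I N) := by
    intro r
    induction r with
    | zero =>
      intro k hk s hs
      obtain rfl : k = N := by omega
      exact ⟨1, s, .loopFalse (hend s hs), by omega, hs⟩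
    | succ r ih =>
      intro k hk s hs
      obtain ⟨hb, t, s', hr, ht, hs'⟩ := hstep k (by omega) s hs
      obtain ⟨t', s'', hr', ht', hs''⟩ := ih (k + 1) (by omega) s' hs'
      refine ⟨t + t' + 1, s'', .loopTrue hb hr hr', ?_, hs''⟩
      rw [add_mul]
      omega
  exact key N 0 (by omega) s h0

/-- Straight-line programs. -/
def block : List Instr → Prog
  | [] => .skip
  | c :: cs => .seq (.instr c) (block cs)

/-- Weakest preconditions of straight-line programs. -/
def blockPre (E : Env) (K : ℕ) : List Instr → (State → Prop) → State → Prop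
  | [], Q, s => Q s
  | c :: cs, Q, s => c.Allowed K s ∧ blockPre E K cs Q (c.exec E s)

lemma Ends.block {cs : List Instr} (h : blockPre E K cs Q s) :
    Ends E K (block cs) s cs.length Q := by
  induction cs generalizing s with
  | nil => exact ⟨0, s, .skip s, le_rfl, h⟩
  | cons c cs ih =>
    obtain ⟨t, s', hr, ht, hQ⟩ := ih h.2
    refine ⟨1 + t, s', .seq (.instr c s h.1) hr, ?_, hQ⟩
    rw [List.length_cons]
    omega

end Rules

/-! ### Inner products -/

/-- Adds to real register `9` the inner product of the `d` memory words from the address in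
integer register `10` on with the `d` input words from the index in integer register `11` on, and
moves integer register `10` behind these words. -/
def dotProg : Prog :=
  .seq (block [.ofInt 9 3, .intConst 6 0])
    (.loop (.intLt 6 1) (block [.load 6 10, .intAdd 8 11 6, .input 7 8, .mul 6 6 7, .add 9 9 6,
      .intAdd 10 10 4, .intAdd 6 6 4]))

/-- The registers other than those used by `dotProg`, the memory and the random sources agree. -/
structure DotFrame (s s' : State) : Prop where
  int_eq : ∀ r, r ≠ 6 → r ≠ 8 → r ≠ 10 → s'.int r = s.int r
  real_eq : ∀ r, r ≠ 6 → r ≠ 7 → r ≠ 9 → s'.real r = s.real r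
  mem_eq : s'.mem = s.mem
  gaussPos_eq : s'.gaussPos = s.gaussPos
  noisePos_eq : s'.noisePos = s.noisePos

/-- Integer registers 3 and 4 hold the constants 0 and 1 in all programs. Register 10 is left at the
start of the next row, so that successive calls walk through the filters without multiplications. -/
lemma dotProg_ends {E : Env} {K d : ℕ} {s : State} (h1 : s.int 1 = d) (h3 : s.int 3 = 0)
    (h4 : s.int 4 = 1) (hK : s.int 10 + d ≤ K) :
    Ends E K dotProg s (8 * d + 3) fun s' => DotFrame s s' ∧ s'.int 10 = s.int 10 + d ∧
      s'.real 9 = ∑ j ∈ Finset.range d, s.mem (s.int 10 + j) * E.input (s.int 11 + j) := by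
  refine Ends.mono (Ends.seq (Ends.block (Q := fun s' => DotFrame s s' ∧ s'.int 6 = 0 ∧
    s'.int 10 = s.int 10 ∧ s'.real 9 = 0) ?_) (T' := d * (7 + 1) + 1) fun s' hs' => ?_)
    (by simp only [List.length_cons, List.length_nil]; omega) fun _ h => h
  · simp only [blockPre, Instr.Allowed, Instr.exec, State.setInt, State.setReal, true_and]
    refine ⟨⟨?_, ?_, rfl, rfl, rfl⟩, ?_, ?_, ?_⟩
    · intro r h6 h8 h10
      simp [h6]
    · intro r h6 h7 h9
      simp [h9]
    · simp
    · simp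
    · simp [h3]
  · obtain ⟨hf, h6, h10, h9⟩ := hs'
    refine Ends.mono (Ends.loop (T := 7) (N := d) (I := fun k s' => DotFrame s s' ∧
      s'.int 6 = k ∧ s'.int 10 = s.int 10 + k ∧
      s'.real 9 = ∑ j ∈ Finset.range k, s.mem (s.int 10 + j) * E.input (s.int 11 + j))
      ⟨hf, h6, h10, by simp [h9]⟩ ?_ ?_) le_rfl fun s' h => ⟨h.1, h.2.2.1, h.2.2.2⟩
    · rintro k hk u ⟨hf, h6, h10, h9⟩
      refine ⟨?_, Ends.block ?_⟩
      · simp only [Test.Holds]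
        rw [h6, hf.int_eq 1 (by decide) (by decide) (by decide), h1]
        exact hk
      · have h11 : u.int 11 = s.int 11 := hf.int_eq 11 (by decide) (by decide) (by decide)
        have h4' : u.int 4 = 1 := (hf.int_eq 4 (by decide) (by decide) (by decide)).trans h4
        simp only [blockPre, Instr.Allowed, Instr.exec, State.setInt, State.setReal, true_and]
        refine ⟨by omega, ⟨?_, ?_, hf.mem_eq, hf.gaussPos_eq, hf.noisePos_eq⟩, ?_, ?_, ?_⟩
        · intro r h6 h8 h10
          simp [h6, h8, h10, hf.int_eq]
        · intro r h6 h7 h9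
          simp [h6, h7, h9, hf.real_eq]
        · simp [h6, h4']
        · simp [h10, h4', add_assoc]
        · simp [Finset.sum_range_succ, h9, h6, h10, h11, hf.mem_eq]
    · rintro u ⟨hf, h6, -⟩
      simp only [Test.Holds]
      rw [h6, hf.int_eq 1 (by decide) (by decide) (by decide), h1]
      exact lt_irrefl d

/-! ### The query program -/

/-- QUERY. -/
def queryProg : Prog :=
  .seq (block [.intConst 3 0, .intConst 4 1, .intConst 5 0, .intConst 11 0, .load 5 3, .ofInt 0 3,
    .intAdd 10 4 0])
  (.loop (.intLt 5 0) (.seq dotProg (.seq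
    (.ite (.realLe 5 9) (block [.intAdd 8 4 5, .load 6 8, .add 0 0 6]) .skip)
    (block [.intAdd 5 5 4]))))

open Classical in
lemma queryProg_ends {E : Env} {K d m : ℕ} {s : State} (h0 : s.int 0 = m) (h1 : s.int 1 = d)
    (hK : 1 + m + m * d ≤ K) :
    Ends E K queryProg s (8 + m * (8 * d + 9)) fun s' => s'.int 0 = m ∧ s'.int 1 = d ∧
      s'.mem = s.mem ∧ s'.real 0 = ∑ i ∈ Finset.range m,
        if s.mem 0 ≤ ∑ j ∈ Finset.range d, s.mem (1 + m + (i * d + j)) * E.input j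
          then s.mem (1 + i) else 0 := by
  have hstart : Ends E K (block [.intConst 3 0, .intConst 4 1, .intConst 5 0, .intConst 11 0,
      .load 5 3, .ofInt 0 3, .intAdd 10 4 0]) s 7 fun u => u.int 0 = m ∧ u.int 1 = d ∧
      u.int 3 = 0 ∧ u.int 4 = 1 ∧ u.int 11 = 0 ∧ u.mem = s.mem ∧ u.real 5 = s.mem 0 ∧
      u.int 5 = 0 ∧ u.int 10 = 1 + m ∧ u.real 0 = 0 := by
    refine Ends.block ?_
    simp [blockPre, Instr.Allowed, Instr.exec, State.setInt, State.setReal, h0, h1]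
    omega
  refine Ends.mono (Ends.seq hstart (T' := m * ((8 * d + 8) + 1) + 1) fun u hu => ?_)
    (by ring_nf; omega) fun _ h => h
  obtain ⟨u0, u1, u3, u4, u11, um, ur5, u5, u10, ur0⟩ := hu
  -- After k rounds register 10 points to row k and real register 0 holds the answer restricted to
  -- the first k filters. A round costs 8d + 3 for the inner product, at most 4 for the test and
  -- update, and 1 for the increment.
  refine Ends.mono (Ends.loop (N := m) (T := 8 * d + 8) (I := fun k u => u.int 0 = m ∧
      u.int 1 = d ∧ u.int 3 = 0 ∧ u.int 4 = 1 ∧ u.int 11 = 0 ∧ u.mem = s.mem ∧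
      u.real 5 = s.mem 0 ∧ u.int 5 = k ∧ u.int 10 = 1 + m + k * d ∧
      u.real 0 = ∑ i ∈ Finset.range k,
        if s.mem 0 ≤ ∑ j ∈ Finset.range d, s.mem (1 + m + (i * d + j)) * E.input j
          then s.mem (1 + i) else 0)
    ⟨u0, u1, u3, u4, u11, um, ur5, u5, by omega, by simpa using ur0⟩ ?_ ?_) le_rfl ?_
  · rintro k hk v ⟨v0, v1, v3, v4, v11, vm, vr5, v5, v10, vr0⟩
    refine ⟨by simp only [Test.Holds]; omega, ?_⟩
    have hkd : (k + 1) * d ≤ m * d := Nat.mul_le_mul_right d hk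
    rw [add_mul, one_mul] at hkd
    refine Ends.mono (Ends.seq (dotProg_ends v1 v3 v4 (by omega)) (T' := 4 + 1) fun w hw => ?_)
      (by omega) fun _ h => h
    obtain ⟨hf, w10, w9⟩ := hw
    have hi := hf.int_eq
    have hr := hf.real_eq
    rw [vm, v10, v11] at w9
    simp only [zero_add, add_assoc (1 + m)] at w9
    have w0 : w.int 0 = m := (hi 0 (by decide) (by decide) (by decide)).trans v0
    have w1 : w.int 1 = d := (hi 1 (by decide) (by decide) (by decide)).trans v1
    have w3 : w.int 3 = 0 := (hi 3 (by decide) (by decide) (by decide)).trans v3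
    have w4 : w.int 4 = 1 := (hi 4 (by decide) (by decide) (by decide)).trans v4
    have w5 : w.int 5 = k := (hi 5 (by decide) (by decide) (by decide)).trans v5
    have w11 : w.int 11 = 0 := (hi 11 (by decide) (by decide) (by decide)).trans v11
    have wr5 := (hr 5 (by decide) (by decide) (by decide)).trans vr5
    have wr0 := (hr 0 (by decide) (by decide) (by decide)).trans vr0
    have wm : w.mem = s.mem := hf.mem_eq.trans vm
    refine Ends.seq (Ends.ite (T := 3) (Q := fun u => u.int 0 = m ∧
      u.int 1 = d ∧ u.int 3 = 0 ∧ u.int 4 = 1 ∧ u.int 11 = 0 ∧ u.mem = s.mem ∧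
      u.real 5 = s.mem 0 ∧ u.int 5 = k ∧ u.int 10 = 1 + m + (k + 1) * d ∧
      u.real 0 = ∑ i ∈ Finset.range (k + 1),
        if s.mem 0 ≤ ∑ j ∈ Finset.range d, s.mem (1 + m + (i * d + j)) * E.input j
          then s.mem (1 + i) else 0) ?_ ?_) ?_
    · intro hle
      simp only [Test.Holds] at hle
      rw [w9, wr5] at hle
      refine Ends.block ?_
      simp [blockPre, Instr.Allowed, Instr.exec, State.setInt, State.setReal, w0, w1, w3, w4, w5,
        w11, wr5, wr0, wm, w10, v10, Finset.sum_range_succ, hle]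
      refine ⟨by omega, by ring⟩
    · intro hle
      simp only [Test.Holds] at hle
      rw [w9, wr5] at hle
      refine Ends.mono (Ends.block (cs := []) ?_) (Nat.zero_le 3) fun _ h => h
      simp only [blockPre]
      refine ⟨w0, w1, w3, w4, w11, wm, wr5, w5, by rw [w10, v10]; ring, ?_⟩
      rw [Finset.sum_range_succ, if_neg hle, add_zero, wr0]
    · rintro u ⟨u0, u1, u3, u4, u11, um, ur5, u5, u10, ur0⟩
      refine Ends.block ?_
      simp [blockPre, Instr.Allowed, Instr.exec, State.setInt, u0, u1, u3, u4,
        u11, um, ur5, u5, u10, ur0]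
  · rintro v ⟨v0, -, -, -, -, -, -, v5, -⟩
    simp only [Test.Holds]
    omega
  · rintro v ⟨v0, v1, -, -, -, vm, -, -, -, vr0⟩
    exact ⟨v0, v1, vm, vr0⟩

/-! ### The construction program -/

/-- Computes the number of filters (integer register `0`), the truncation radius (real register
`4`) and the threshold (memory word `0`). -/
def headerProg : Prog :=
  block [.intConst 3 0, .intConst 4 1, .intAdd 2 0 3, .ofInt 12 4, .ofInt 13 3,
    .mul 5 1 1, .sub 5 12 5, .mul 6 0 1, .sub 6 12 6, .mul 6 6 6, .div 5 5 6, .ofInt 6 2,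
    .log 6 6, .mul 6 6 5, .exp 6 6, .ceil 0 6,
    .ofInt 6 0, .log 6 6, .add 7 6 6, .sqrt 7 7, .mul 7 0 7, .log 6 6, .mul 8 0 0, .sub 8 12 8,
    .add 8 8 8, .mul 8 8 6, .sqrt 8 8, .sub 5 7 8,
    .add 7 3 3, .exp 6 2, .sub 6 6 12, .div 6 6 7, .add 6 12 6, .log 6 6, .div 7 12 2, .mul 4 7 6,
    .store 3 5]

/-- Sets all counters to `0`. -/
def clearProg : Prog :=
  .seq (block [.intConst 5 0])
    (.loop (.intLt 5 0) (block [.intAdd 8 4 5, .store 8 13, .intAdd 5 5 4]))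

/-- Draws the filters. -/
def filterProg : Prog :=
  .seq (block [.intConst 5 0, .intMul 9 0 1, .intAdd 10 4 0])
    (.loop (.intLt 5 9) (block [.gauss 6, .intAdd 8 10 5, .store 8 6, .intAdd 5 5 4]))

/-- Finds the filter with the largest inner product with the point whose coordinates start at the
input index in integer register `11`. -/
def argmaxProg : Prog :=
  .seq (block [.intConst 5 0, .intAdd 10 4 0])
    (.loop (.intLt 5 0) (.seq dotProg (.seq
      (.ite (.intLt 3 5)
        (.ite (.realLe 9 8) .skip (block [.add 8 9 13, .intAdd 9 5 3]))
        (block [.add 8 9 13, .intAdd 9 5 3]))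
      (block [.intAdd 5 5 4]))))

/-- Counts the points assigned to each filter. -/
def countProg : Prog :=
  .seq (block [.intConst 7 0, .intConst 11 0])
    (.loop (.intLt 7 2) (.seq argmaxProg (block [.intAdd 8 4 9, .load 6 8, .add 6 6 12,
      .store 8 6, .intAdd 11 11 1, .intAdd 7 7 4])))

/-- Adds noise to the counters and replaces small ones by `0`. -/
def noiseProg : Prog :=
  .seq (block [.intConst 5 0])
    (.loop (.intLt 5 0) (.seq (block [.intAdd 8 4 5, .load 6 8, .noise 7, .add 6 6 7])
      (.seq (.ite (.realLe 6 4) (block [.store 8 13]) (block [.store 8 6]))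
        (block [.intAdd 5 5 4]))))

/-- CONSTRUCTION. -/
def constructionProg : Prog :=
  .seq headerProg (.seq clearProg (.seq filterProg (.seq countProg noiseProg)))

/-- The registers that stay constant after the header. -/
structure Base (m d n : ℕ) (A : ℝ) (s : State) : Prop where
  i0 : s.int 0 = m
  i1 : s.int 1 = d
  i2 : s.int 2 = n
  i3 : s.int 3 = 0
  i4 : s.int 4 = 1
  r4 : s.real 4 = A
  r12 : s.real 12 = 1
  r13 : s.real 13 = 0

lemma base_iff {m d n : ℕ} {A : ℝ} {s : State} : Base m d n A s ↔ s.int 0 = m ∧ s.int 1 = d ∧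
    s.int 2 = n ∧ s.int 3 = 0 ∧ s.int 4 = 1 ∧ s.real 4 = A ∧ s.real 12 = 1 ∧ s.real 13 = 0 :=
  ⟨fun h => ⟨h.i0, h.i1, h.i2, h.i3, h.i4, h.r4, h.r12, h.r13⟩,
    fun ⟨h0, h1, h2, h3, h4, h5, h6, h7⟩ => ⟨h0, h1, h2, h3, h4, h5, h6, h7⟩⟩

lemma headerProg_ends {E : Env} {K n d : ℕ} {α β ε δ : ℝ} {s : State} (hK : 0 < K) (hn : 1 ≤ n)
    (h0 : s.int 0 = n) (h1 : s.int 1 = d) (r0 : s.real 0 = α) (r1 : s.real 1 = β)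
    (r2 : s.real 2 = ε) (r3 : s.real 3 = δ) :
    Ends E K headerProg s 37 fun u =>
      Base (numFilters n α β) d n (tlapRadius 1 ε δ) u ∧
      u.mem 0 = threshold (numFilters n α β) α ∧ u.gaussPos = s.gaussPos ∧
      u.noisePos = s.noisePos := by
  -- The machine has no power instruction: n^σ is computed as exp(σ log n), which is valid since n ≥
  -- 1.
  have hm : ⌈Real.exp (Real.log n * ((1 - β * β) / ((1 - α * β) * (1 - α * β))))⌉₊ =
      numFilters n α β := by
    have hn0 : (0 : ℝ) < n := by exact_mod_cast hn
    rw [numFilters, Real.rpow_def_of_pos hn0, sq, sq]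
  refine Ends.block ?_
  simp only [blockPre, Instr.Allowed, Instr.exec, State.setInt, State.setReal, true_and,
    Function.update_apply, Nat.reduceEqDiff, if_true, if_false, h0, r0, r1, r2, r3]
  simp [hm, hK, base_iff, tlapRadius, threshold, sq, two_mul, h1, add_mul]

/-- The memory holds the threshold `η`, the counters `c` and the first draws of the Gaussian
source as filters. -/
structure Table (E : Env) (m d : ℕ) (η : ℝ) (c : ℕ → ℝ) (s : State) : Prop where
  eta : s.mem 0 = η
  counter : ∀ i < m, s.mem (1 + i) = c i
  filter : ∀ t < m * d, s.mem (1 + m + t) = E.gauss t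

lemma Table.congr {E : Env} {m d : ℕ} {η : ℝ} {c c' : ℕ → ℝ} {s s' : State}
    (h : Table E m d η c s) (hs : s'.mem = s.mem) (hc : ∀ i < m, c i = c' i) :
    Table E m d η c' s' :=
  ⟨by rw [hs, h.eta], fun i hi => by rw [hs, h.counter i hi, hc i hi],
    fun t ht => by rw [hs, h.filter t ht]⟩

lemma Table.update {E : Env} {m d : ℕ} {η : ℝ} {c : ℕ → ℝ} {s s' : State}
    (h : Table E m d η c s) {i : ℕ} (hi : i < m) {v : ℝ}
    (hs : s'.mem = Function.update s.mem (1 + i) v) :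
    Table E m d η (Function.update c i v) s' := by
  refine ⟨?_, fun j hj => ?_, fun t ht => ?_⟩
  · rw [hs, Function.update_of_ne (by omega), h.eta]
  · rw [hs]
    rcases eq_or_ne j i with rfl | hne
    · rw [Function.update_self, Function.update_self]
    · rw [Function.update_of_ne (by omega), Function.update_of_ne hne, h.counter j hj]
  · rw [hs, Function.update_of_ne (by omega), h.filter t ht]

/-! ### Effect and step count of each phase of CONSTRUCTION. -/

section Phases

variable {E : Env} {K m d n : ℕ} {A η : ℝ}

/-- `Init` says nothing about the initial memory, so the counters must be cleared. -/
lemma clearProg_ends {s : State} (hK : 1 + m + m * d ≤ K) (hb : Base m d n A s)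
    (hη : s.mem 0 = η) :
    Ends E K clearProg s (2 + m * 4) fun u => Base m d n A u ∧ u.mem 0 = η ∧
      (∀ i < m, u.mem (1 + i) = 0) ∧ u.gaussPos = s.gaussPos ∧ u.noisePos = s.noisePos := by
  refine Ends.mono (Ends.seq (T := 1) (T' := m * (3 + 1) + 1)
    (R := fun u => Base m d n A u ∧ u.int 5 = 0 ∧ u.mem 0 = η ∧ u.gaussPos = s.gaussPos ∧
      u.noisePos = s.noisePos) (Ends.block ?_) fun u hu => ?_) (by omega) fun _ h => h
  · have hb' := base_iff.1 hb
    simpa [blockPre, Instr.Allowed, Instr.exec, State.setInt, base_iff, hη] using hb'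
  · obtain ⟨ub, u5, um, ug, un⟩ := hu
    refine Ends.mono (Ends.loop (N := m) (T := 3) (I := fun k u => Base m d n A u ∧ u.int 5 = k ∧
      u.mem 0 = η ∧ (∀ i < k, u.mem (1 + i) = 0) ∧ u.gaussPos = s.gaussPos ∧
      u.noisePos = s.noisePos)
      ⟨ub, u5, um, fun i hi => absurd hi (Nat.not_lt_zero i), ug, un⟩ ?_ ?_) le_rfl
      fun v ⟨vb, _, vm, vc, vp⟩ => ⟨vb, vm, vc, vp⟩
    · rintro k hk v ⟨vb, v5, vm, vc, vg, vn⟩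
      refine ⟨by simp only [Test.Holds, vb.i0, v5, hk], Ends.block ?_⟩
      have vb' := base_iff.1 vb
      simp [blockPre, Instr.Allowed, Instr.exec, State.setInt, base_iff, vb', v5, vg, vn]
      refine ⟨by omega, by rw [Function.update_of_ne (by omega), vm], fun i hi => ?_⟩
      rcases eq_or_ne i k with rfl | hne
      · rw [Function.update_self]
      · rw [Function.update_of_ne (by omega), vc i (by omega)]
    · rintro v ⟨vb, v5, -⟩
      simp [Test.Holds, vb.i0, v5]

lemma filterProg_ends {s : State} (hK : 1 + m + m * d ≤ K) (hb : Base m d n A s)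
    (hη : s.mem 0 = η) (hc : ∀ i < m, s.mem (1 + i) = 0) (hg : s.gaussPos = 0) :
    Ends E K filterProg s (4 + m * d * 5) fun u => Base m d n A u ∧
      Table E m d η (fun _ => 0) u ∧ u.noisePos = s.noisePos := by
  refine Ends.mono (Ends.seq (T := 3) (T' := m * d * (4 + 1) + 1)
    (R := fun u => Base m d n A u ∧ u.int 5 = 0 ∧ u.int 9 = m * d ∧ u.int 10 = 1 + m ∧
      u.mem = s.mem ∧ u.gaussPos = 0 ∧
      u.noisePos = s.noisePos) (Ends.block ?_) fun u hu => ?_) (by omega) fun _ h => h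
  · have hb' := base_iff.1 hb
    simp [blockPre, Instr.Allowed, Instr.exec, State.setInt, base_iff, hb', hg]
  · obtain ⟨ub, u5, u9, u10, um, ug, un⟩ := hu
    refine Ends.mono (Ends.loop (N := m * d) (T := 4) (I := fun k u => Base m d n A u ∧
      u.int 5 = k ∧ u.int 9 = m * d ∧ u.int 10 = 1 + m ∧ u.mem 0 = η ∧
      (∀ i < m, u.mem (1 + i) = 0) ∧ (∀ t < k, u.mem (1 + m + t) = E.gauss t) ∧
      u.gaussPos = k ∧ u.noisePos = s.noisePos)
      ⟨ub, u5, u9, u10, by rw [um, hη], by rwa [um], fun i hi => absurd hi (Nat.not_lt_zero i),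
        ug, un⟩ ?_ ?_) le_rfl
      fun v ⟨vb, _, _, _, vm, vc, vf, _, vn⟩ => ⟨vb, ⟨vm, vc, vf⟩, vn⟩
    · rintro k hk v ⟨vb, v5, v9, v10, vm, vc, vf, vg, vn⟩
      refine ⟨by simp only [Test.Holds, v9, v5, hk], Ends.block ?_⟩
      have vb' := base_iff.1 vb
      simp [blockPre, Instr.Allowed, Instr.exec, State.setInt, State.setReal, base_iff, vb', v5,
        v9, v10, vg, vn]
      refine ⟨by omega, by rw [Function.update_of_ne (by omega), vm], fun i hi => ?_,
        fun t ht => ?_⟩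
      · rw [Function.update_of_ne (by omega), vc i hi]
      · rcases eq_or_ne t k with rfl | hne
        · rw [Function.update_self]
        · rw [Function.update_of_ne (by omega), vf t (by omega)]
    · rintro v ⟨vb, v5, v9, -⟩
      simp [Test.Holds, v9, v5]

/-- The inner product of a filter with a point of the input. -/
def filterDot (E : Env) (d i k : ℕ) : ℝ :=
  ∑ j ∈ Finset.range d, E.gauss (i * d + j) * E.input (k * d + j)

/-- `b` is the first index below `m` with the largest inner product with point `k`. -/
def IsFirstMax (E : Env) (m d k b : ℕ) : Prop :=
  b < m ∧ (∀ j < m, filterDot E d j k ≤ filterDot E d b k) ∧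
    ∀ j < b, filterDot E d j k < filterDot E d b k

/-- Invariant: after i > 0 rounds, integer register 9 holds the first maximizer among the filters
below i, and real register 8 its inner product. -/
lemma argmaxProg_ends {s : State} {c : ℕ → ℝ} {k N : ℕ} (hm : 0 < m) (hK : 1 + m + m * d ≤ K)
    (hb : Base m d n A s) (ht : Table E m d η c s) (h7 : s.int 7 = k) (h11 : s.int 11 = k * d)
    (hN : s.noisePos = N) :
    Ends E K argmaxProg s (3 + m * (8 * d + 9)) fun u => Base m d n A u ∧ Table E m d η c u ∧
      u.int 7 = k ∧ u.int 11 = k * d ∧ u.noisePos = N ∧ IsFirstMax E m d k (u.int 9) := by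
  refine Ends.mono (Ends.seq (T := 2) (T' := m * (8 * d + 8 + 1) + 1)
    (R := fun u => Base m d n A u ∧ Table E m d η c u ∧ u.int 7 = k ∧ u.int 11 = k * d ∧
      u.noisePos = N ∧ u.int 5 = 0 ∧ u.int 10 = 1 + m) (Ends.block ?_) fun u hu => ?_)
    (by ring_nf; omega) fun _ h => h
  · have hb' := base_iff.1 hb
    simp [blockPre, Instr.Allowed, Instr.exec, State.setInt, base_iff, hb', h7, h11, hN]
    exact ht.congr rfl fun _ _ => rfl
  · obtain ⟨ub, ut, u7, u11, uN, u5, u10⟩ := hu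
    refine Ends.mono (Ends.loop (N := m) (T := 8 * d + 8) (I := fun i u => Base m d n A u ∧
      Table E m d η c u ∧ u.int 7 = k ∧ u.int 11 = k * d ∧ u.noisePos = N ∧ u.int 5 = i ∧
      u.int 10 = 1 + m + i * d ∧
      (0 < i → IsFirstMax E i d k (u.int 9) ∧ u.real 8 = filterDot E d (u.int 9) k))
      ⟨ub, ut, u7, u11, uN, u5, by omega, fun h => absurd h (lt_irrefl 0)⟩ ?_ ?_) le_rfl
      fun v ⟨vb, vt, v7, v11, vN, _, _, vmax⟩ => ⟨vb, vt, v7, v11, vN, (vmax hm).1⟩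
    · rintro i hi v ⟨vb, vt, v7, v11, vN, v5, v10, vmax⟩
      refine ⟨by simp only [Test.Holds, vb.i0, v5, hi], ?_⟩
      have hid : (i + 1) * d ≤ m * d := Nat.mul_le_mul_right d hi
      rw [add_mul, one_mul] at hid
      refine Ends.mono (Ends.seq (dotProg_ends vb.i1 vb.i3 vb.i4 (by omega)) (T' := 4 + 1)
        fun w hw => ?_) (by omega) fun _ h => h
      obtain ⟨hf, w10, w9⟩ := hw
      have hint := hf.int_eq
      have hreal := hf.real_eq
      have wdot : w.real 9 = filterDot E d i k := by
        rw [w9, filterDot]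
        refine Finset.sum_congr rfl fun j hj => ?_
        rw [v10, v11, add_assoc (1 + m), vt.filter]
        have := Finset.mem_range.1 hj
        omega
      have wb : Base m d n A w := by
        constructor <;> first
          | (rw [hint _ (by decide) (by decide) (by decide)])
          | (rw [hreal _ (by decide) (by decide) (by decide)])
        exacts [vb.i0, vb.i1, vb.i2, vb.i3, vb.i4, vb.r4, vb.r12, vb.r13]
      have wt : Table E m d η c w := vt.congr hf.mem_eq fun _ _ => rfl
      have w7 : w.int 7 = k := (hint 7 (by decide) (by decide) (by decide)).trans v7
      have w11 : w.int 11 = k * d := (hint 11 (by decide) (by decide) (by decide)).trans v11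
      have w5 : w.int 5 = i := (hint 5 (by decide) (by decide) (by decide)).trans v5
      have wN : w.noisePos = N := hf.noisePos_eq.trans vN
      have w10' : w.int 10 = 1 + m + (i + 1) * d := by rw [w10, v10]; ring
      have wi9 := hint 9 (by decide) (by decide) (by decide)
      have wr8 := hreal 8 (by decide) (by decide) (by decide)
      rw [← wi9, ← wr8] at vmax
      have wb' := base_iff.1 wb
      -- The record is replaced only by a strictly larger value, so ties keep the earlier index. In
      -- round 0 there is no record yet and the replacement is unconditional.
      have hupd : (0 < i → filterDot E d (w.int 9) k < filterDot E d i k) →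
          IsFirstMax E (i + 1) d k i := by
        intro hlt
        have hall : ∀ j < i, filterDot E d j k < filterDot E d i k := fun j hj =>
          ((vmax (by omega)).1.2.1 j hj).trans_lt (hlt (by omega))
        refine ⟨Nat.lt_succ_self i, fun j hj => ?_, hall⟩
        rcases Nat.lt_succ_iff_lt_or_eq.1 hj with h | rfl
        · exact (hall j h).le
        · exact le_rfl
      refine Ends.seq (T := 4) (R := fun u => Base m d n A u ∧
        Table E m d η c u ∧ u.int 7 = k ∧ u.int 11 = k * d ∧ u.noisePos = N ∧ u.int 5 = i ∧
        u.int 10 = 1 + m + (i + 1) * d ∧ IsFirstMax E (i + 1) d k (u.int 9) ∧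
          u.real 8 = filterDot E d (u.int 9) k) ?_ ?_
      -- Both instructions are copies, made by adding the constant 0.
      · have hset : (0 < i → filterDot E d (w.int 9) k < filterDot E d i k) →
            Ends E K (block [.add 8 9 13, .intAdd 9 5 3]) w 2 fun u => Base m d n A u ∧
            Table E m d η c u ∧ u.int 7 = k ∧ u.int 11 = k * d ∧ u.noisePos = N ∧ u.int 5 = i ∧
            u.int 10 = 1 + m + (i + 1) * d ∧ IsFirstMax E (i + 1) d k (u.int 9) ∧
              u.real 8 = filterDot E d (u.int 9) k := by
          intro hlt
          refine Ends.block ?_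
          simp [blockPre, Instr.Allowed, Instr.exec, State.setInt, State.setReal, base_iff, wb',
            w7, w11, w5, wN, w10', wdot, hupd hlt]
          exact wt.congr rfl fun _ _ => rfl
        refine Ends.ite (T := 3) (fun hpos => ?_) fun hpos => ?_
        · simp only [Test.Holds, wb.i3, w5] at hpos
          refine Ends.ite (T := 2) (fun hle => ?_) fun hle => ?_
          · simp only [Test.Holds, wdot, (vmax hpos).2] at hle
            refine Ends.mono (Ends.block (cs := []) ?_) (Nat.zero_le 2) fun _ h => h
            obtain ⟨⟨h1, h2, h3⟩, h4⟩ := vmax hpos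
            refine ⟨wb, wt, w7, w11, wN, w5, w10', ⟨h1.trans (Nat.lt_succ_self i),
              fun j hj => ?_, h3⟩, h4⟩
            rcases Nat.lt_succ_iff_lt_or_eq.1 hj with h | rfl
            · exact h2 j h
            · exact hle
          · simp only [Test.Holds, wdot, (vmax hpos).2] at hle
            exact hset fun _ => not_le.1 hle
        · simp only [Test.Holds, wb.i3, w5] at hpos
          exact (hset fun h => absurd h hpos).mono (by norm_num) fun _ h => h
      · rintro u ⟨ub, ut, u7, u11, uN, u5, u10, umax, ur8⟩
        have ub' := base_iff.1 ub
        refine Ends.block ?_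
        simp [blockPre, Instr.Allowed, Instr.exec, State.setInt, base_iff, ub',
            u7, u11, u5, uN, u10, umax, ur8]
        exact ut.congr rfl fun _ _ => rfl
    · rintro v ⟨vb, -, -, -, -, v5, -⟩
      simp [Test.Holds, vb.i0, v5]

lemma IsFirstMax.unique {k b b' : ℕ} (h : IsFirstMax E m d k b) (h' : IsFirstMax E m d k b') :
    b = b' := by
  rcases lt_trichotomy b b' with hlt | heq | hlt
  · exact absurd (h'.2.2 b hlt) (not_lt.2 (h.2.1 b' h'.1))
  · exact heq
  · exact absurd (h.2.2 b' hlt) (not_lt.2 (h'.2.1 b h.1))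

open Classical in
/-- The number of the first `k` points that are assigned to filter `i`. -/
def firstMaxCount (E : Env) (m d k i : ℕ) : ℕ :=
  ((Finset.range k).filter fun k' => IsFirstMax E m d k' i).card

lemma firstMaxCount_succ {k b : ℕ} (h : IsFirstMax E m d k b) (i : ℕ) :
    (firstMaxCount E m d (k + 1) i : ℝ) = Function.update
      (fun i => (firstMaxCount E m d k i : ℝ)) b (firstMaxCount E m d k b + 1) i := by
  classical
  rw [firstMaxCount, Finset.range_add_one, Finset.filter_insert]
  rcases eq_or_ne i b with rfl | hne
  · rw [if_pos h, Finset.card_insert_of_notMem (by simp), Function.update_self, Nat.cast_succ]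
    rfl
  · rw [if_neg fun h' => hne (h'.unique h), Function.update_of_ne hne]
    rfl

lemma countProg_ends {s : State} (hm : 0 < m) (hK : 1 + m + m * d ≤ K)
    (hb : Base m d n A s) (ht : Table E m d η (fun _ => 0) s) (hN : s.noisePos = 0) :
    Ends E K countProg s (3 + n * (10 + m * (8 * d + 9))) fun u => Base m d n A u ∧
      Table E m d η (fun i => firstMaxCount E m d n i) u ∧ u.noisePos = 0 := by
  refine Ends.mono (Ends.seq (T := 2) (T' := n * (9 + m * (8 * d + 9) + 1) + 1)
    (R := fun u => Base m d n A u ∧ Table E m d η (fun _ => 0) u ∧ u.int 7 = 0 ∧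
      u.int 11 = 0 ∧ u.noisePos = 0) (Ends.block ?_) fun u hu => ?_)
    (by ring_nf; omega) fun _ h => h
  · have hb' := base_iff.1 hb
    simp [blockPre, Instr.Allowed, Instr.exec, State.setInt, base_iff, hb', hN]
    exact ht.congr rfl fun _ _ => rfl
  · obtain ⟨ub, ut, u7, u11, uN⟩ := hu
    -- After k rounds the table counts the first k points, and register 11 is the input index of
    -- point k. Uniqueness of the first maximizer makes each round change one counter only.
    refine Ends.mono (Ends.loop (N := n) (T := 9 + m * (8 * d + 9)) (I := fun k u =>
      Base m d n A u ∧ Table E m d η (fun i => firstMaxCount E m d k i) u ∧ u.int 7 = k ∧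
      u.int 11 = k * d ∧ u.noisePos = 0)
      ⟨ub, ut.congr rfl fun _ _ => by simp [firstMaxCount], u7, by omega, uN⟩ ?_ ?_) le_rfl
      fun v ⟨vb, vt, _, _, vN⟩ => ⟨vb, vt, vN⟩
    · rintro k hk v ⟨vb, vt, v7, v11, vN⟩
      refine ⟨by simp only [Test.Holds, vb.i2, v7, hk], ?_⟩
      refine Ends.mono (Ends.seq (argmaxProg_ends hm hK vb vt v7 v11 vN) (T' := 6)
        fun w hw => ?_) (by omega) fun _ h => h
      obtain ⟨wb, wt, w7, w11, wN, wmax⟩ := hw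
      have wb' := base_iff.1 wb
      have hlt := wmax.1
      refine Ends.block ?_
      simp [blockPre, Instr.Allowed, Instr.exec, State.setInt, State.setReal, base_iff, wb', w7,
        w11, wN, wt.counter _ wmax.1]
      refine ⟨by omega, ?_, by ring⟩
      exact (Table.update wt hlt rfl).congr rfl fun i _ => (firstMaxCount_succ wmax i).symm
    · rintro v ⟨vb, -, v7, -⟩
      simp [Test.Holds, vb.i2, v7]

lemma noiseProg_ends {s : State} {c : ℕ → ℝ} (hK : 1 + m + m * d ≤ K)
    (hb : Base m d n A s) (ht : Table E m d η c s) (hN : s.noisePos = 0) :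
    Ends E K noiseProg s (2 + m * 8) fun u => Base m d n A u ∧
      Table E m d η (fun i => if c i + E.noise i ≤ A then 0 else c i + E.noise i) u := by
  refine Ends.mono (Ends.seq (T := 1) (T' := m * (7 + 1) + 1)
    (R := fun u => Base m d n A u ∧ Table E m d η c u ∧ u.int 5 = 0 ∧ u.noisePos = 0)
    (Ends.block ?_) fun u hu => ?_) (by omega) fun _ h => h
  · have hb' := base_iff.1 hb
    simp [blockPre, Instr.Allowed, Instr.exec, State.setInt, base_iff, hb', hN]
    exact ht.congr rfl fun _ _ => rfl
  · obtain ⟨ub, ut, u5, uN⟩ := hu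
    -- After k rounds the counters below k are final and the others still exact; the same k is the
    -- position in the noise source.
    refine Ends.mono (Ends.loop (N := m) (T := 7) (I := fun k u => Base m d n A u ∧
      Table E m d η (fun i => if i < k then
        if c i + E.noise i ≤ A then 0 else c i + E.noise i else c i) u ∧ u.int 5 = k ∧
      u.noisePos = k)
      ⟨ub, ut.congr rfl fun _ _ => by simp, u5, uN⟩ ?_ ?_) le_rfl
      fun v ⟨vb, vt, _, _⟩ => ⟨vb, vt.congr rfl fun i hi => by rw [if_pos hi]⟩
    · rintro k hk v ⟨vb, vt, v5, vN⟩
      refine ⟨by simp only [Test.Holds, vb.i0, v5, hk], ?_⟩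
      have vc := vt.counter k hk
      rw [if_neg (lt_irrefl k)] at vc
      have vb' := base_iff.1 vb
      refine Ends.mono (Ends.seq (T := 4) (R := fun w => Base m d n A w ∧ w.mem = v.mem ∧
        w.int 5 = k ∧ w.int 8 = 1 + k ∧ w.noisePos = k + 1 ∧ w.real 6 = c k + E.noise k)
        (Ends.block ?_) (T' := 3) fun w hw => ?_) le_rfl fun _ h => h
      · simp [blockPre, Instr.Allowed, Instr.exec, State.setInt, State.setReal, base_iff, vb', v5,
          vN, vc]
        omega
      obtain ⟨wb, wm, w5, w8, wN, w6⟩ := hw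
      have wb' := base_iff.1 wb
      obtain ⟨c', hc'⟩ : ∃ c' : ℕ → ℝ, ∀ i, c' i = if i < k + 1 then
        if c i + E.noise i ≤ A then 0 else c i + E.noise i else c i := ⟨_, fun _ => rfl⟩
      have hupd : ∀ u : State, u.mem = Function.update v.mem (1 + k)
          (if c k + E.noise k ≤ A then 0 else c k + E.noise k) → Table E m d η c' u := by
        intro u hu
        refine (vt.update hk hu).congr rfl fun i _ => ?_
        rw [hc']
        rcases eq_or_ne i k with rfl | hne
        · rw [Function.update_self, if_pos (Nat.lt_succ_self i)]
        · rw [Function.update_of_ne hne]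
          exact if_congr (by omega) rfl rfl
      refine Ends.seq (T := 2) (T' := 1) (R := fun u => Base m d n A u ∧
        Table E m d η c' u ∧ u.int 5 = k ∧ u.noisePos = k + 1) (Ends.ite (T := 1) (fun hle => ?_) fun hle => ?_) ?_
      · simp only [Test.Holds, w6, wb.r4] at hle
        refine Ends.block ?_
        simp [blockPre, Instr.Allowed, Instr.exec, base_iff, wb', w5, w8, wN]
        refine ⟨by omega, hupd _ ?_⟩
        rw [if_pos hle, wm]
      · simp only [Test.Holds, w6, wb.r4] at hle
        refine Ends.block ?_
        simp [blockPre, Instr.Allowed, Instr.exec, base_iff, wb', w5, w8, wN]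
        refine ⟨by omega, hupd _ ?_⟩
        rw [if_neg hle, wm, w6]
      · rintro u ⟨ub, ut, u5, uN⟩
        have ub' := base_iff.1 ub
        refine Ends.block ⟨trivial, base_iff.2 ?_, ut.congr rfl fun i _ => hc' i, ?_, uN⟩ <;>
          simp [Instr.exec, State.setInt, ub', u5]
    · rintro v ⟨vb, -, v5, -⟩
      simp [Test.Holds, vb.i0, v5]

end Phases

lemma constructionProg_ends {E : Env} {K n d : ℕ} {α β ε δ : ℝ} {s : State} (hn : 1 ≤ n)
    (hm : 0 < numFilters n α β)
    (hK : 1 + numFilters n α β + numFilters n α β * d ≤ K)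
    (h0 : s.int 0 = n) (h1 : s.int 1 = d) (r0 : s.real 0 = α) (r1 : s.real 1 = β)
    (r2 : s.real 2 = ε) (r3 : s.real 3 = δ) (hg : s.gaussPos = 0) (hz : s.noisePos = 0) :
    Ends E K constructionProg s (48 + 12 * numFilters n α β + 5 * (numFilters n α β * d) +
      n * (10 + numFilters n α β * (8 * d + 9))) fun u =>
      u.int 0 = numFilters n α β ∧ u.int 1 = d ∧
      Table E (numFilters n α β) d (threshold (numFilters n α β) α)
        (fun i => if (firstMaxCount E (numFilters n α β) d n i : ℝ) + E.noise i ≤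
          tlapRadius 1 ε δ then 0
          else (firstMaxCount E (numFilters n α β) d n i : ℝ) + E.noise i) u := by
  have hhead := headerProg_ends (E := E) (by omega : 0 < K) hn h0 h1 r0 r1 r2 r3
  generalize numFilters n α β = m at *
  refine Ends.mono (Ends.seq hhead (T' := (2 + m * 4) + ((4 + m * d * 5) +
    ((3 + n * (10 + m * (8 * d + 9))) + (2 + m * 8)))) fun u hu => ?_) (by omega) fun _ h => h
  obtain ⟨ub, um, ug, un⟩ := hu
  refine Ends.seq (clearProg_ends hK ub um) fun v hv => ?_
  obtain ⟨vb, vm, vc, vg, vn⟩ := hv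
  refine Ends.seq (filterProg_ends hK vb vm vc (by rw [vg, ug, hg])) fun w hw => ?_
  obtain ⟨wb, wt, wn⟩ := hw
  refine Ends.seq (countProg_ends hm hK wb wt (by rw [wn, vn, un, hz])) fun y hy => ?_
  obtain ⟨yb, yt, yn⟩ := hy
  exact (noiseProg_ends hK yb yt yn).mono le_rfl fun u hu => ⟨hu.1.i0, hu.1.i1, hu.2⟩

/-! ### The programs compute the data structure and the query answer -/

section Correctness

variable {n d m : ℕ} {x : Fin n → Sph d} {g : Fin m → Fin d → ℝ} {E : Env}

lemma inner_eq_filterDot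
    (hx : ∀ (i : Fin n) (j : Fin d), E.input (i * d + j) = (x i : Vec d) j)
    (hg : ∀ (i : Fin m) (j : Fin d), E.gauss (i * d + j) = g i j) (i : Fin m) (k : Fin n) :
    ⟪toFilters g i, (x k : Vec d)⟫ = filterDot E d i k := by
  rw [filterDot, Finset.sum_range, PiLp.inner_apply]
  refine Finset.sum_congr rfl fun j _ => ?_
  rw [hg, hx]
  simp [toFilters, mul_comm]

lemma isFirstMax_iff
    (hx : ∀ (i : Fin n) (j : Fin d), E.input (i * d + j) = (x i : Vec d) j)
    (hg : ∀ (i : Fin m) (j : Fin d), E.gauss (i * d + j) = g i j) (i : Fin m) (k : Fin n) :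
    IsFirstMax E m d k i ↔ IsArgmax (toFilters g) (x k : Vec d) i := by
  simp only [IsFirstMax, IsArgmax, inner_eq_filterDot hx hg]
  refine ⟨fun h => ⟨fun j => h.2.1 j j.2, fun j hj => h.2.2 j hj⟩, fun h => ⟨i.2,
    fun j hj => h.1 ⟨j, hj⟩, fun j hj => h.2 ⟨j, hj.trans i.2⟩ hj⟩⟩

lemma firstMaxCount_eq_bucketCount
    (hx : ∀ (i : Fin n) (j : Fin d), E.input (i * d + j) = (x i : Vec d) j)
    (hg : ∀ (i : Fin m) (j : Fin d), E.gauss (i * d + j) = g i j) (i : Fin m) :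
    firstMaxCount E m d n i = bucketCount (toFilters g) (Finset.univ.val.map x) i := by
  classical
  rw [bucketCount_map, firstMaxCount, Finset.card_filter, Finset.card_filter, Finset.sum_range]
  exact Finset.sum_congr rfl fun k _ => if_congr (isFirstMax_iff hx hg i k) rfl rfl

end Correctness

lemma mul_add_lt {d m : ℕ} (i : Fin m) (j : Fin d) : (i : ℕ) * d + j < m * d := by
  have h : ((i : ℕ) + 1) * d ≤ m * d := Nat.mul_le_mul_right d i.2
  rw [add_mul, one_mul] at h
  have := j.2
  omega

lemma constructionProg_correct {n d : ℕ} {α β ε δ : ℝ} {x : Fin n → Sph d}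
    {g : Fin (numFilters n α β) → Fin d → ℝ} {z : Fin (numFilters n α β) → ℝ} {E : Env}
    {s : State} {K : ℕ} (hn : 1 ≤ n) (hm : 0 < numFilters n α β)
    (hK : 1 + numFilters n α β + numFilters n α β * d ≤ K) (hs : Init α β ε δ x g z E s) :
    Ends E K constructionProg s (48 + 12 * numFilters n α β + 5 * (numFilters n α β * d) +
      n * (10 + numFilters n α β * (8 * d + 9))) fun u =>
      Stores u (build n α β ε δ (Finset.univ.val.map x) g z) := by
  obtain ⟨h0, h1, r0, r1, r2, r3, hgp, hzp, hx, hg, hz⟩ := hs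
  refine (constructionProg_ends hn hm hK h0 h1 r0 r1 r2 r3 hgp hzp).mono le_rfl
    fun u ⟨u0, u1, ut⟩ => ⟨u0, u1, ut.eta, fun i => ?_, fun i j => ?_⟩
  · rw [ut.counter i i.2, firstMaxCount_eq_bucketCount hx hg i, hz]
    rfl
  · rw [ut.filter _ (mul_add_lt i j), hg]
    rfl

lemma queryProg_correct {d m : ℕ} {D : Data d m} {q : Sph d} {E : Env} {s : State} {K : ℕ}
    (hK : 1 + m + m * d ≤ K) (hs : Stores s D) (hq : ∀ j : Fin d, E.input j = (q : Vec d) j) :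
    Ends E K queryProg s (8 + m * (8 * d + 9)) fun u => Stores u D ∧ u.real 0 = D.query q := by
  obtain ⟨h0, h1, hη, hT, hF⟩ := hs
  refine (queryProg_ends h0 h1 hK).mono le_rfl fun u ⟨u0, u1, um, ur⟩ => ⟨⟨u0, u1, ?_⟩, ?_⟩
  · rw [um]
    exact ⟨hη, hT, hF⟩
  · classical
    rw [ur, Finset.sum_range, Data.query, Finset.sum_filter]
    refine Finset.sum_congr rfl fun i _ => ?_
    have hin : ∑ j ∈ Finset.range d, s.mem (1 + m + (i * d + j)) * E.input j =
        ⟪D.filters i, (q : Vec d)⟫ := by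
      rw [Finset.sum_range, PiLp.inner_apply]
      refine Finset.sum_congr rfl fun j _ => ?_
      rw [hF, hq]
      simp [mul_comm]
    rw [hin, hη, hT]

theorem exists_programs : ∃ (pre qry : Prog) (C : ℝ), ∀ (d n : ℕ), 1 ≤ d → 1 ≤ n →
    ∀ α β ε δ : ℝ, 0 ≤ β → β < α → α < 1 → 0 < ε → 0 < δ → δ < 1 / 2 →
    ∃ K : ℕ, (K : ℝ) ≤ C * (d * (n : ℝ) ^ (rho α β / (1 - α ^ 2))) ∧
      ∀ (x : Fin n → Sph d) (g : Fin (numFilters n α β) → Fin d → ℝ)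
        (z : Fin (numFilters n α β) → ℝ) (D : Data d (numFilters n α β)),
        D = build n α β ε δ (Finset.univ.val.map x) g z →
        D.words ≤ K ∧
        (∀ (E : Env) (s : State), Init α β ε δ x g z E s →
          ∃ (t : ℕ) (s' : State), Run E K pre s t s' ∧
            (t : ℝ) ≤ C * (d * (n : ℝ) ^ (1 + rho α β / (1 - α ^ 2))) ∧ Stores s' D) ∧
        ∀ (q : Sph d) (E : Env) (s : State),
          Stores s D → (∀ j : Fin d, E.input j = (q : Vec d) j) →
          ∃ (t : ℕ) (s' : State), Run E K qry s t s' ∧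
            (t : ℝ) ≤ C * (d * (n : ℝ) ^ (rho α β / (1 - α ^ 2))) ∧
            Stores s' D ∧ s'.real 0 = D.query q := by
  -- As m, n, d ≥ 1, construction takes at most (48+12+5+10+8+9)·nmd = 92nmd steps, and a query at
  -- most 25md. With m ≤ 2n^σ the factors are 184 and 50.
  refine ⟨constructionProg, queryProg, 200, fun d n hd hn α β ε δ hβ0 hβ hα _ _ _ => ?_⟩
  have hm := numFilters_pos hn hβ0 hβ hα
  have hmle := numFilters_le hn hβ0 hβ hα
  have hn0 : (0 : ℝ) < n := by exact_mod_cast hn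
  rw [rho_div hβ0 hβ hα, Real.rpow_add hn0, Real.rpow_one]
  set P : ℝ := (n : ℝ) ^ ((1 - β ^ 2) / (1 - α * β) ^ 2)
  have hmd : numFilters n α β ≤ numFilters n α β * d := Nat.le_mul_of_pos_right _ hd
  have hmdP : ((numFilters n α β * d : ℕ) : ℝ) ≤ 2 * (d * P) := by
    push_cast
    nlinarith [(Nat.cast_nonneg d : (0 : ℝ) ≤ d)]
  have hsmall : ∀ t : ℕ, t ≤ 25 * (numFilters n α β * d) → (t : ℝ) ≤ 200 * (d * P) := by
    intro t ht
    have h1 : (t : ℝ) ≤ 25 * ((numFilters n α β * d : ℕ) : ℝ) := by exact_mod_cast ht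
    have h2 : (0 : ℝ) ≤ ((numFilters n α β * d : ℕ) : ℝ) := Nat.cast_nonneg _
    linarith
  have hlarge : ∀ t : ℕ, t ≤ 92 * (n * (numFilters n α β * d)) →
      (t : ℝ) ≤ 200 * (d * (n * P)) := by
    intro t ht
    have h1 : (t : ℝ) ≤ 92 * (n * ((numFilters n α β * d : ℕ) : ℝ)) := by exact_mod_cast ht
    have h2 := mul_le_mul_of_nonneg_left hmdP hn0.le
    have h3 : (0 : ℝ) ≤ n * ((numFilters n α β * d : ℕ) : ℝ) := by positivity
    nlinarith
  -- The machine gets exactly the words occupied by the data structure; all other values fit in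
  -- registers.
  refine ⟨1 + numFilters n α β + numFilters n α β * d, hsmall _ (by omega), ?_⟩
  rintro x g z D rfl
  refine ⟨le_rfl, fun E s hs => ?_, fun q E s hs hq => ?_⟩
  · obtain ⟨t, s', hr, ht, hst⟩ := constructionProg_correct hn hm le_rfl hs
    refine ⟨t, s', hr, hlarge t (ht.trans ?_), hst⟩
    generalize numFilters n α β = m at hm hmd
    have h1 : m * d ≤ n * (m * d) := Nat.le_mul_of_pos_left _ hn
    have h2 : n * m ≤ n * (m * d) := Nat.mul_le_mul_left n hmd
    have h3 : n * 1 ≤ n * m := Nat.mul_le_mul_left n hm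
    have h4 : n * (10 + m * (8 * d + 9)) = 10 * n + 8 * (n * (m * d)) + 9 * (n * m) := by ring
    omega
  · obtain ⟨t, s', hr, ht, hst⟩ := queryProg_correct le_rfl hs hq
    refine ⟨t, s', hr, hsmall t (ht.trans ?_), hst⟩
    have h4 : numFilters n α β * (8 * d + 9) =
        8 * (numFilters n α β * d) + 9 * numFilters n α β := by ring
    omega

end RAM

end DPTopOne

end

theorem theorem1 :
    -- privacy
    (∀ (d n : ℕ) (α β ε δ : ℝ), 0 ≤ β → β < α → α < 1 → 0 < ε → 0 < δ → δ < 1 / 2 →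
      (∀ S : Multiset (Sph d), IsProbabilityMeasure (construction n α β ε δ S)) ∧
      IsDP ε δ (fun S : Multiset (Sph d) => construction n α β ε δ S)) ∧
    -- accuracy, as the number of points tends to infinity
    (∀ α β : ℕ → ℝ, (∀ n, 0 ≤ β n) → (∀ n, β n < α n) → (∀ n, α n < 1) →
      (fun n : ℕ => (1 - α n ^ 2) * √(Real.log (Real.log n) / Real.log n))
        =o[atTop] (fun n => α n - β n) →
      (fun n : ℕ => Real.log (Real.log (numFilters n (α n) (β n))) /
          Real.log (numFilters n (α n) (β n)))
        =o[atTop] (fun n => 1 - α n ^ 2) →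
      ∃ e₁ e₂ : ℕ → ℝ, Tendsto e₁ atTop (𝓝 0) ∧ Tendsto e₂ atTop (𝓝 0) ∧
        ∀ ε₀ : ℝ, 0 < ε₀ → ∃ C : ℝ, 0 < C ∧ ∀ᶠ n : ℕ in atTop,
          ∀ (d : ℕ) (ε δ : ℝ), 0 < ε → ε ≤ ε₀ → 0 < δ → δ < 1 / 2 →
          ∀ (S : Multiset (Sph d)) (q : Sph d), S.card = n →
            2 / 3 ≤ construction n (α n) (β n) ε δ S
              {D | (1 - e₁ n) * (ballCount S q (α n) : ℝ)
                      - C * (Real.log (1 / δ) / ε * (n : ℝ) ^ (rho (α n) (β n) + e₂ n))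
                    ≤ D.query q ∧
                  D.query q ≤ (ballCount S q (β n) : ℝ)
                      + C * (Real.log (1 / δ) / ε * (n : ℝ) ^ (rho (α n) (β n) + e₂ n))}) ∧
    -- preprocessing time, space and query time
    (∃ (pre qry : RAM.Prog) (C : ℝ), ∀ (d n : ℕ), 1 ≤ d → 1 ≤ n →
      ∀ α β ε δ : ℝ, 0 ≤ β → β < α → α < 1 → 0 < ε → 0 < δ → δ < 1 / 2 →
      ∃ K : ℕ, (K : ℝ) ≤ C * (d * (n : ℝ) ^ (rho α β / (1 - α ^ 2))) ∧
        ∀ (x : Fin n → Sph d) (g : Fin (numFilters n α β) → Fin d → ℝ)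
          (z : Fin (numFilters n α β) → ℝ) (D : Data d (numFilters n α β)),
          D = build n α β ε δ (Finset.univ.val.map x) g z →
          D.words ≤ K ∧
          (∀ (E : RAM.Env) (s : RAM.State), RAM.Init α β ε δ x g z E s →
            ∃ (t : ℕ) (s' : RAM.State), RAM.Run E K pre s t s' ∧
              (t : ℝ) ≤ C * (d * (n : ℝ) ^ (1 + rho α β / (1 - α ^ 2))) ∧ RAM.Stores s' D) ∧
          ∀ (q : Sph d) (E : RAM.Env) (s : RAM.State),
            RAM.Stores s D → (∀ j : Fin d, E.input j = (q : Vec d) j) →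
            ∃ (t : ℕ) (s' : RAM.State), RAM.Run E K qry s t s' ∧
              (t : ℝ) ≤ C * (d * (n : ℝ) ^ (rho α β / (1 - α ^ 2))) ∧
              RAM.Stores s' D ∧ s'.real 0 = D.query q) :=
  ⟨fun _ n α β _ _ _ _ _ hε hδ hδ' =>
      ⟨isProbabilityMeasure_construction n α β hε hδ hδ', construction_isDP n α β hε hδ hδ'⟩,
    fun _ _ hβ0 hβ hα _ h => construction_accuracy_eventually hβ0 hβ hα h,
    RAM.exists_programs⟩
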